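/- Let $(X,d)$ be a complete separable metric space and $m$ a nonzero, locally finite, nonnegative Borel measure on $X$ that is doubling ($m(B_{2r}(x))\le C\,m(B_r(x))$ for all $x\in X$, $r>0$) and supports a weak local $(1,p_0)$-Poincaré inequality for some $p_0\ge 1$. That is, for some constants $C_{PI}$ and $\lambda\ge1$ and all Lipschitz $f:X\to\mathbb R$, $x\in X$, $r>0$, writing $B=B_r(x)$ and $f_B$ for the $m$-average of $f$ over $B$, $$\frac1{m(B)}\int_{B}|f-f_{B}|\,dm\le 2rC_{PI}\Big(\frac1{m(B_{\lambda r}(x))}\int_{B_{\lambda r}(x)}|Df|^{p_0}\,dm\Big)^{1/p_0},$$ where $|Df|$ is the local Lipschitz constant. Let $\Omega\subset X$ be open and let $p,q>1$ be conjugate exponents with $p\ge p_0$. *Sobolev classes.* A $q$-test plan is a Borel probability measure $\pi$ on $C([0,1],X)$, concentrated on $q$-absolutely continuous curves, with $\iint_0^1|\dot\gamma_t|^q\,dt\,d\pi(\gamma)<\infty$ and, for some constant $C$, $(e_t)_\sharp\pi\le Cm$ for all $t\in[0,1]$, where $e_t(\gamma)=\gamma_t$. A Borel function $f:X\to\mathbb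 R$ is in $S^p_{loc}(X)$ if there is a $p$-weak upper gradient of $f$, i.e. a nonnegative $G\in L^p_{loc}(X,m)$ with $$\int|f(\gamma_1)-f(\gamma_0)|\,d\pi(\gamma)\le\iint_0^1G(\gamma_s)|\dot\gamma_s|\,ds\,d\pi(\gamma)$$ for all $q$-test plans $\pi$; the $m$-a.e. minimal one is denoted $|Df|_w$. A Borel function $f:\Omega\to\mathbb R$ is in $S^p_{loc}(\Omega)$ if $\chi f\in S^p_{loc}(X)$ for every Lipschitz $\chi:X\to[0,1]$ with compact support in $\Omega$, and then $|Df|_w:=|D(\chi f)|_w$ $m$-a.e. on $\{\chi=1\}$. For $f,g\in S^p_{loc}(\Omega)$ put $$D^{+}f(\nabla g)=\liminf_{\varepsilon\downarrow0}\frac{|D(g+\varepsilon f)|_w^p-|Dg|_w^p}{p\,\varepsilon\,|Dg|_w^{p-2}},\qquad D^{-}f(\nabla g)=\limsup_{\varepsilon\uparrow0}\frac{|D(g+\varepsilon f)|_w^p-|Dg|_w^p}{p\,\varepsilon\,|Dg|_w^{p-2}}$$ on $\{|Dg|_w\neq0\}$, and $0$ on $\{|Dg|_w=0\}$ (each $m$-a.e.;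 the limits may be taken along rational $\varepsilon$). *Divergence.* Let $\mathrm{Test}(\Omega)$ be the set of Lipschitz functions $X\to\mathbb R$ with compact support contained in $\Omega$. A Radon measure on $\Omega$ is here a signed one, i.e. a difference of two nonnegative Radon measures on $\Omega$, and $\mu\le\nu$ means $\mu(B)\le\nu(B)$ for all Borel $B$ relatively compact in $\Omega$. For $g\in S^p_{loc}(\Omega)$ and $h\in L^q_{loc}(\Omega)$, write $\mu\in\mathbf{div}(h\nabla g)|_\Omega$ if $\mu$ is a Radon measure on $\Omega$ with $$-\int_\Omega D^{\mathrm{sign}(h)}f(\nabla g)\,h\,dm\le\int_\Omega f\,d\mu\le-\int_\Omega D^{-\mathrm{sign}(h)}f(\nabla g)\,h\,dm\qquad\text{for all } f\in\mathrm{Test}(\Omega),$$ and write $h\nabla g\in D(\mathbf{div},\Omega)$ if such a $\mu$ exists. **Proposition.** Let $g\in S^p_{loc}(\Omega)$ and $h\in L^q_{loc}(\Omega)$, and suppose that there is a Radon measure $\tilde\mu$ on $\Omega$ such that $$-\int_\Omega D^{-\mathrm{sign}(h)}f(\nabla g)\,h\,dm\le\int_\Omega f\,d\tilde\mu\qquad\text{for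 all nonnegative } f\in\mathrm{Test}(\Omega).$$ Then $h\nabla g\in D(\mathbf{div},\Omega)$, and every $\mu\in\mathbf{div}(h\nabla g)|_\Omega$ satisfies $\mu\le\tilde\mu$. -/

import Mathlib

open MeasureTheory Filter Topology Set
open scoped ENNReal NNReal

/-! ### Curves -/

section Curves

variable {X : Type*} [MetricSpace X]

/-- `C([0,1], X)` carries the Borel σ-algebra of uniform convergence. -/
instance curveMeasurableSpace : MeasurableSpace C(unitInterval, X) := borel _

instance curveBorelSpace : BorelSpace C(unitInterval, X) := ⟨rfl⟩

/-- The curve `γ` is `q`-absolutely continuous: `d(γ_s, γ_t) ≤ ∫_s^t φ` for all `s ≤ t`,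
for some `φ ∈ L^q([0,1])`. -/
def IsACq (q : ℝ) (γ : C(unitInterval, X)) : Prop :=
  ∃ φ : unitInterval → ℝ≥0∞, Measurable φ ∧ ∫⁻ r, φ r ^ q < ∞ ∧
    ∀ s t : unitInterval, s ≤ t → edist (γ s) (γ t) ≤ ∫⁻ r in Icc s t, φ r

/-- The metric speed of `γ`. The upper limit is a limit for almost every `t` if `γ` is
absolutely continuous. -/
noncomputable def metricSpeed (γ : C(unitInterval, X)) (t : unitInterval) : ℝ≥0∞ :=
  limsup (fun s => edist (γ s) (γ t) / edist s t) (𝓝[≠] t)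

/-- The local Lipschitz constant `|Df|(x) = limsup_{y → x} |f y - f x| / d(x, y)`
(it is `0` at isolated points). -/
noncomputable def localLip (f : X → ℝ) (x : X) : ℝ≥0∞ :=
  limsup (fun y => edist (f y) (f x) / edist y x) (𝓝[≠] x)

end Curves

/-! ### Metric measure spaces -/

section MetricMeasure

variable {X : Type*} [MetricSpace X] [MeasurableSpace X]

/-- The doubling condition. -/
def IsDoubling (m : Measure X) : Prop :=
  ∃ C : ℝ≥0, ∀ (x : X) (r : ℝ), 0 < r →
    m (Metric.ball x (2 * r)) ≤ C * m (Metric.ball x r)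

/-- The weak local `(1, p₀)`-Poincaré inequality, for Lipschitz functions and their local
Lipschitz constants. -/
def SupportsPoincare (p₀ : ℝ) (m : Measure X) : Prop :=
  ∃ C lam : ℝ≥0, 1 ≤ lam ∧ ∀ (x : X) (r : ℝ), 0 < r →
    ∀ f : X → ℝ, (∃ K, LipschitzWith K f) →
      ⨍⁻ y in Metric.ball x r, ‖f y - ⨍ z in Metric.ball x r, f z ∂m‖ₑ ∂m ≤
        C * ENNReal.ofReal (2 * r) *
          (⨍⁻ y in Metric.ball x (lam * r), localLip f y ^ p₀ ∂m) ^ (1 / p₀)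

/-! ### Test plans and weak upper gradients -/

/-- `q`-test plans. -/
structure IsTestPlan (q : ℝ) (m : Measure X) (π : Measure C(unitInterval, X)) : Prop where
  prob : IsProbabilityMeasure π
  compression : ∃ C : ℝ≥0, ∀ t : unitInterval,
    π.map (fun γ : C(unitInterval, X) => γ t) ≤ C • m
  ac : ∀ᵐ γ ∂π, IsACq q γ
  energy : ∫⁻ γ, (∫⁻ t, metricSpeed γ t ^ q) ∂π < ∞

/-- `G : X → [0, ∞]` is a `p`-weak upper gradient, in `L^p_loc`, of the function `f`. -/
structure IsWeakUpperGradient (p : ℝ) (m : Measure X) (f : X → ℝ) (G : X → ℝ≥0∞) : Prop where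
  measurable : Measurable G
  locInt : ∀ K : Set X, IsCompact K → ∫⁻ x in K, G x ^ p ∂m < ∞
  upper : ∀ q : ℝ, p.HolderConjugate q → ∀ π : Measure C(unitInterval, X), IsTestPlan q m π →
    ∫⁻ γ, ‖f (γ 1) - f (γ 0)‖ₑ ∂π ≤
      ∫⁻ γ, (∫⁻ s, G (γ s) * metricSpeed γ s) ∂π

/-- The Sobolev class `S^p_loc(X)`. -/
def MemSobolevLoc (p : ℝ) (m : Measure X) (f : X → ℝ) : Prop :=
  Measurable f ∧ ∃ G, IsWeakUpperGradient p m f G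

/-- `G` is the essential infimum (greatest lower bound up to `m`-null sets) of the `p`-weak
upper gradients of `f`. -/
structure IsMinimalGradient (p : ℝ) (m : Measure X) (f : X → ℝ) (G : X → ℝ≥0∞) : Prop where
  measurable : Measurable G
  le : ∀ H, IsWeakUpperGradient p m f H → G ≤ᵐ[m] H
  greatest : ∀ H : X → ℝ≥0∞, Measurable H →
    (∀ H', IsWeakUpperGradient p m f H' → H ≤ᵐ[m] H') → H ≤ᵐ[m] G

open Classical in
/-- The minimal `p`-weak upper gradient `|Df|_w` of a function on `X`
(a representative of an `m`-a.e. class). -/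
noncomputable def minimalGradient (p : ℝ) (m : Measure X) (f : X → ℝ) : X → ℝ≥0∞ :=
  if h : ∃ G, IsMinimalGradient p m f G then h.choose else fun _ => ∞

/-- A weak upper gradient that is a.e. below every other one is the minimal gradient. -/
theorem minimalGradient_ae_eq {p : ℝ} {m : Measure X} {f : X → ℝ} {G : X → ℝ≥0∞}
    (hG : IsWeakUpperGradient p m f G)
    (hmin : ∀ H, IsWeakUpperGradient p m f H → G ≤ᵐ[m] H) :
    minimalGradient p m f =ᵐ[m] G := by
  have h : ∃ G, IsMinimalGradient p m f G :=
    ⟨G, hG.measurable, hmin, fun H _ hH => hH G hG⟩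
  have hs := h.choose_spec
  have e : minimalGradient p m f = h.choose := by
    unfold minimalGradient
    rw [dif_pos h]
  rw [e]
  exact (hs.le G hG).antisymm (hs.greatest G hG.measurable hmin)

/-! ### Localization to an open set -/

/-- Test functions: Lipschitz functions on `X` with compact support contained in `Ω`. -/
def IsTest (Ω : Set X) (f : X → ℝ) : Prop :=
  (∃ K, LipschitzWith K f) ∧ HasCompactSupport f ∧ tsupport f ⊆ Ω

/-- Lipschitz cutoff functions `X → [0,1]` compactly supported in `Ω`. -/
def IsCutoff (Ω : Set X) (χ : X → ℝ) : Prop :=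
  IsTest Ω χ ∧ ∀ x, χ x ∈ Icc (0 : ℝ) 1

/-- The class `S^p_loc(Ω)`; only the values of `f` on `Ω` matter. -/
def MemSobolevLocOn (p : ℝ) (m : Measure X) (Ω : Set X) (f : X → ℝ) : Prop :=
  Measurable (Ω.indicator f) ∧
    ∀ χ : X → ℝ, IsCutoff Ω χ → MemSobolevLoc p m (fun x => χ x * f x)

/-- The class `L^q_loc(Ω)`. -/
def MemLpLocOn (q : ℝ) (m : Measure X) (Ω : Set X) (h : X → ℝ) : Prop :=
  ∀ K : Set X, IsCompact K → K ⊆ Ω → MemLp h (ENNReal.ofReal q) (m.restrict K)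

/-- Sequences of cutoff functions such that the interiors of the sets `{χ n = 1}`
cover `Ω`. -/
def IsCutoffSeq (Ω : Set X) (χ : ℕ → X → ℝ) : Prop :=
  (∀ n, IsCutoff Ω (χ n)) ∧ ∀ x ∈ Ω, ∃ n, ∀ᶠ y in 𝓝 x, χ n y = 1

open Classical in
/-- A fixed sequence of cutoff functions in `Ω` (it exists if `X` is proper and `Ω` is open). -/
noncomputable def cutoffSeq (Ω : Set X) : ℕ → X → ℝ :=
  if h : ∃ χ, IsCutoffSeq Ω χ then h.choose else fun _ _ => 0

open Classical in
/-- `|Df|_w` on `Ω` for `f ∈ S^p_loc(Ω)`: it is `|D(χ f)|_w` on `{χ = 1}` for `χ` in a countable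
family of cutoff functions. By locality of minimal gradients, the choice of the family
matters only on an `m`-null set. -/
noncomputable def weakGradient (p : ℝ) (m : Measure X) (Ω : Set X) (f : X → ℝ) (x : X) : ℝ :=
  if h : ∃ n, cutoffSeq Ω n x = 1 then
    (minimalGradient p m (fun y => cutoffSeq Ω (Nat.find h) y * f y) x).toReal
  else 0

/-! ### The functions `D^±f(∇g)` -/

/-- `(|D(g + ε f)|^p - |Dg|^p) / (p ε |Dg|^{p-2})`. -/
noncomputable def gradQuotient (p : ℝ) (m : Measure X) (Ω : Set X) (f g : X → ℝ) (ε : ℝ)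
    (x : X) : ℝ :=
  (weakGradient p m Ω (fun y => g y + ε * f y) x ^ p - weakGradient p m Ω g x ^ p) /
    (p * ε * weakGradient p m Ω g x ^ (p - 2))

open Classical in
/-- `D⁺f(∇g)`. The parameter `ε ↓ 0` is rational, since `|D(g + ε f)|` is only defined
almost everywhere for each `ε`. -/
noncomputable def Dplus (p : ℝ) (m : Measure X) (Ω : Set X) (f g : X → ℝ) (x : X) : ℝ :=
  if weakGradient p m Ω g x = 0 then 0
  else liminf (fun ε : ℚ => gradQuotient p m Ω f g (ε : ℝ) x) (𝓝[>] (0 : ℚ))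

open Classical in
/-- `D⁻f(∇g)`. -/
noncomputable def Dminus (p : ℝ) (m : Measure X) (Ω : Set X) (f g : X → ℝ) (x : X) : ℝ :=
  if weakGradient p m Ω g x = 0 then 0
  else limsup (fun ε : ℚ => gradQuotient p m Ω f g (ε : ℝ) x) (𝓝[<] (0 : ℚ))

open Classical in
/-- `D^{sign s}f(∇g)`; it is only used multiplied by `± s`, so the value at `s = 0` is
immaterial. -/
noncomputable def Dsign (p : ℝ) (m : Measure X) (Ω : Set X) (s : ℝ) (f g : X → ℝ) (x : X) : ℝ :=
  if 0 < s then Dplus p m Ω f g x else Dminus p m Ω f g x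

end MetricMeasure

/-! ### Signed Radon measures -/

/-- A signed Radon measure, presented as a difference `pos - neg` of two nonnegative Radon
measures. Both may have infinite total mass. -/
structure SignedRadonMeasure (Y : Type*) [TopologicalSpace Y] [MeasurableSpace Y] where
  pos : Measure Y
  neg : Measure Y
  pos_regular : pos.Regular
  neg_regular : neg.Regular

namespace SignedRadonMeasure

variable {Y : Type*} [TopologicalSpace Y] [MeasurableSpace Y]

/-- The integral of a function (meaningful if it is integrable for both parts, in particular for
continuous functions with compact support). -/
noncomputable def integral (μ : SignedRadonMeasure Y) (f : Y → ℝ) : ℝ :=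
  (∫ y, f y ∂μ.pos) - ∫ y, f y ∂μ.neg

/-- The value of a signed Radon measure on a relatively compact Borel set. -/
noncomputable def value (μ : SignedRadonMeasure Y) (B : Set Y) : ℝ :=
  μ.pos.real B - μ.neg.real B

/-- `μ ≤ ν`: `μ(B) ≤ ν(B)` for all relatively compact Borel sets `B`. -/
instance : LE (SignedRadonMeasure Y) where
  le μ ν := ∀ B : Set Y, MeasurableSet B → IsCompact (closure B) → μ.value B ≤ ν.value B

end SignedRadonMeasure

/-! ### The divergence -/

section Divergence

variable {X : Type*} [MetricSpace X] [MeasurableSpace X]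

/-- `μ ∈ div(h ∇g)` on `Ω`. -/
def IsDivergence (p : ℝ) (m : Measure X) (Ω : Set X) (h g : X → ℝ)
    (μ : SignedRadonMeasure Ω) : Prop :=
  ∀ f : X → ℝ, IsTest Ω f →
    -∫ x in Ω, Dsign p m Ω (h x) f g x * h x ∂m ≤ μ.integral (fun x : Ω => f x) ∧
    μ.integral (fun x : Ω => f x) ≤ -∫ x in Ω, Dsign p m Ω (-h x) f g x * h x ∂m

/-- `h ∇g ∈ D(div, Ω)`. -/
def MemDivDomain (p : ℝ) (m : Measure X) (Ω : Set X) (h g : X → ℝ) : Prop :=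
  ∃ μ : SignedRadonMeasure Ω, IsDivergence p m Ω h g μ

end Divergence

/-! ### Absolutely continuous curves -/

/-! Write `T f = -∫ D^{-sign h}f(∇g) h dm` for test functions `f` (this is `divUpper`). The proof
finds a linear functional below `T` and represents its difference from `μt` by a measure.

Since `D⁻f = -D⁺(-f)`, the integrand of `T` is `h⁻ D⁺f(∇g) + h⁺ D⁺(-f)(∇g)`, with nonnegative
weights. The map `ε ↦ |D(g + εf)|_w` is convex, so the lower limit in `D⁺` is a limit, equal to
`|Dg|_w` times the right slope at `0`. It follows that `D⁺f(∇g)` is subadditive and positively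
homogeneous in `f`, with `|D⁺f(∇g)| ≤ |Dg|_w |Df|_w`. As `|Df|_w` is bounded and vanishes off the
support of `f`, Hölder's inequality makes `T` a finite sublinear functional.

Hahn–Banach gives a linear `L ≤ T` (`exists_linearMap_le_divUpper`), and applying this to `-f` gives
the lower bound in the definition of the divergence. By hypothesis `T ≤ μt` on nonnegative test
functions, so `μt - L` is a positive functional. It is integration against a Radon measure `ν`
(`exists_regular_integral_eq`), and `μt - ν` is a divergence.

For any divergence `μ`, nonnegative `f` satisfy `∫ f dμ ≤ T f ≤ ∫ f dμt`. Regularity turns this into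
`μ ≤ μt`, because Lipschitz cutoffs fit between a compact set and an open neighbourhood of it.
Doubling enters through properness of `X`, which provides compactly supported cutoffs. -/

theorem absolutelyContinuousOnInterval_of_edist_le {Y : Type*} [PseudoMetricSpace Y]
    {u : ℝ → Y} {ψ : ℝ → ℝ≥0∞} {a b : ℝ} (hψ : ∫⁻ t in uIoc a b, ψ t ≠ ∞)
    (hu : ∀ s ∈ uIcc a b, ∀ t ∈ uIcc a b, edist (u s) (u t) ≤ ∫⁻ r in uIoc s t, ψ r) :
    AbsolutelyContinuousOnInterval u a b := by
  -- Absolute continuity of the integral: families of disjoint intervals of vanishing total length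
  -- carry vanishing mass of `ψ`.
  have h0 := tendsto_setLIntegral_zero hψ
    (AbsolutelyContinuousOnInterval.tendsto_volume_restrict_totalLengthFilter_disjWithin_nhds_zero
      a b)
  have h1 := (ENNReal.continuousAt_toReal (by simp)).tendsto.comp h0
  rw [ENNReal.toReal_zero] at h1
  refine squeeze_zero' (.of_forall fun _ => Finset.sum_nonneg fun _ _ => dist_nonneg) ?_ h1
  filter_upwards [mem_inf_of_right (mem_principal_self _)] with ⟨n, I⟩ hI
  have hsub : (⋃ i ∈ Finset.range n, uIoc (I i).1 (I i).2) ⊆ uIoc a b :=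
    AbsolutelyContinuousOnInterval.biUnion_uIoc_subset_of_mem_disjWithin hI
  have hfin : ∫⁻ r in (⋃ i ∈ Finset.range n, uIoc (I i).1 (I i).2), ψ r ≠ ∞ :=
    ((lintegral_mono_set hsub).trans_lt hψ.lt_top).ne
  have hm : MeasurableSet (⋃ i ∈ Finset.range n, uIoc (I i).1 (I i).2) :=
    Finset.measurableSet_biUnion _ fun _ _ => measurableSet_uIoc
  simp only [Function.comp_apply]
  -- This also turns `hfin` into finiteness of the sum over the intervals.
  rw [Measure.restrict_restrict hm, inter_eq_left.2 hsub,
    lintegral_biUnion_finset hI.2 (fun _ _ => measurableSet_uIoc)] at *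
  rw [ENNReal.toReal_sum fun i hi => (ENNReal.sum_ne_top.1 hfin) i hi]
  refine Finset.sum_le_sum fun i hi => ?_
  rw [dist_edist]
  exact ENNReal.toReal_mono ((ENNReal.sum_ne_top.1 hfin) i hi) (hu _ (hI.1 i hi).1 _ (hI.1 i hi).2)

theorem AbsolutelyContinuousOnInterval.enorm_sub_le_lintegral_deriv {u : ℝ → ℝ} {a b : ℝ}
    (hu : AbsolutelyContinuousOnInterval u a b) (hab : a ≤ b) :
    ‖u b - u a‖ₑ ≤ ∫⁻ t in Icc a b, ‖deriv u t‖ₑ := by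
  rw [← hu.integral_deriv_eq_sub, intervalIntegral.integral_of_le hab]
  exact (enorm_integral_le_lintegral_enorm _).trans (lintegral_mono_set Ioc_subset_Icc_self)

theorem lintegral_unitInterval (f : ℝ → ℝ≥0∞) :
    ∫⁻ t : unitInterval, f t = ∫⁻ t in Icc 0 1, f t :=
  unitInterval.measurePreserving_coe.lintegral_comp_emb
    (MeasurableEmbedding.subtype_coe measurableSet_Icc) f

section Curves

variable {X : Type*} [MetricSpace X]

/-- A `q`-absolutely continuous curve, extended to the real line by constants, is absolutely
continuous on `[0, 1]`. -/
theorem IsACq.absolutelyContinuousOnInterval {q : ℝ} (hq : 1 ≤ q) {γ : C(unitInterval, X)}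
    (hγ : IsACq q γ) :
    AbsolutelyContinuousOnInterval (fun t => γ (projIcc 0 1 zero_le_one t)) 0 1 := by
  obtain ⟨φ, -, hφ, h⟩ := hγ
  have hproj (t : unitInterval) : projIcc (0 : ℝ) 1 zero_le_one t = t := projIcc_val _ t
  have key (s t : ℝ) (hs : s ∈ Icc (0 : ℝ) 1) (ht : t ∈ Icc (0 : ℝ) 1) (hst : s ≤ t) :
      edist (γ (projIcc 0 1 zero_le_one s)) (γ (projIcc 0 1 zero_le_one t)) ≤
        ∫⁻ r in uIoc s t, φ (projIcc 0 1 zero_le_one r) := by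
    have h1 := h ⟨s, hs⟩ ⟨t, ht⟩ hst
    rw [projIcc_of_mem _ hs, projIcc_of_mem _ ht]
    refine h1.trans_eq ?_
    rw [← lintegral_indicator measurableSet_Icc, uIoc_of_le hst,
      setLIntegral_congr Ioc_ae_eq_Icc,
      ← inter_eq_left.2 (Icc_subset_Icc hs.1 ht.2), ← Measure.restrict_restrict measurableSet_Icc,
      ← lintegral_indicator measurableSet_Icc, ← lintegral_unitInterval]
    refine lintegral_congr fun r => ?_
    have e : r ∈ Icc (⟨s, hs⟩ : unitInterval) ⟨t, ht⟩ ↔ (r : ℝ) ∈ Icc s t := Iff.rfl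
    by_cases hr : (r : ℝ) ∈ Icc s t
    · rw [indicator_of_mem (e.2 hr), indicator_of_mem hr, hproj]
    · rw [indicator_of_notMem (mt e.1 hr), indicator_of_notMem hr]
  refine absolutelyContinuousOnInterval_of_edist_le
    (ψ := fun r => φ (projIcc 0 1 zero_le_one r)) ?_ ?_
  · rw [uIoc_of_le zero_le_one, setLIntegral_congr Ioc_ae_eq_Icc, ← lintegral_unitInterval]
    simp only [hproj]
    -- On a space of finite measure `L^q` lies in `L^1`, by `φ ≤ 1 + φ ^ q`.
    refine ne_top_of_le_ne_top (b := ∫⁻ r, (1 + φ r ^ q)) ?_ (lintegral_mono fun r => ?_)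
    · rw [lintegral_add_left measurable_const]
      simpa using hφ.ne
    · rcases le_total (φ r) 1 with h1 | h1
      · exact h1.trans le_self_add
      · refine le_trans ?_ le_add_self
        simpa using ENNReal.rpow_le_rpow_of_exponent_le h1 hq
  · rw [uIcc_of_le zero_le_one]
    intro s hs t ht
    rcases le_total s t with hst | hst
    · exact key s t hs ht hst
    · rw [edist_comm, uIoc_comm]
      exact key t s ht hs hst

/-- Difference quotients of `F ∘ γ` are at most `L` times those of `γ`. If `γ t ∉ K`, the curve
stays in the open complement near `t`, where `F` vanishes. At points of non-differentiability
`deriv` is `0` by convention. -/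
theorem enorm_deriv_comp_projIcc_le {L : ℝ≥0} {F : X → ℝ} (hF : LipschitzWith L F)
    {K : Set X} (hK : IsClosed K) (hFK : ∀ x ∉ K, F x = 0) (γ : C(unitInterval, X))
    (t : unitInterval) :
    ‖deriv (fun s => F (γ (projIcc 0 1 zero_le_one s))) t‖ₑ ≤
      K.indicator (fun _ => (L : ℝ≥0∞)) (γ t) * metricSpeed γ t := by
  set u : ℝ → ℝ := fun s => F (γ (projIcc 0 1 zero_le_one s)) with hu
  have hproj (t : unitInterval) : projIcc (0 : ℝ) 1 zero_le_one t = t := projIcc_val _ t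
  by_cases hd : DifferentiableAt ℝ u t; swap
  · simp [deriv_zero_of_not_differentiableAt hd]
  by_cases hmem : γ t ∈ K; swap
  · have hev : ∀ᶠ s : ℝ in 𝓝 (t : ℝ), u s = 0 := by
      have hc : ContinuousAt (fun s : ℝ => γ (projIcc 0 1 zero_le_one s)) t :=
        (γ.continuous.comp continuous_projIcc).continuousAt
      have := hc.eventually (hK.isOpen_compl.mem_nhds (by simpa [hproj] using hmem))
      filter_upwards [this] with s hs using hFK _ hs
    have : deriv u t = deriv (fun _ : ℝ => (0 : ℝ)) t := EventuallyEq.deriv_eq hev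
    simp [this]
  rw [indicator_of_mem hmem]
  have hval : Tendsto (Subtype.val : unitInterval → ℝ) (𝓝[≠] t) (𝓝[≠] (t : ℝ)) :=
    tendsto_nhdsWithin_iff.2 ⟨(continuous_subtype_val.tendsto t).mono_left nhdsWithin_le_nhds,
      eventually_nhdsWithin_of_forall fun s hs => fun h => hs (Subtype.ext h)⟩
  have hsl := (hasDerivAt_iff_tendsto_slope.1 hd.hasDerivAt).comp hval
  have hsl' := (continuous_enorm.tendsto _).comp hsl
  rw [← hsl'.limsup_eq]
  rw [metricSpeed, ← ENNReal.limsup_const_mul_of_ne_top ENNReal.coe_ne_top]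
  refine limsup_le_limsup (eventually_nhdsWithin_of_forall fun s hs => ?_)
  have hst : (s : ℝ) - t ≠ 0 := sub_ne_zero.2 fun h => hs (Subtype.ext h)
  simp only [Function.comp_apply, slope, vsub_eq_sub, smul_eq_mul, hu, hproj]
  rw [enorm_mul, enorm_inv hst, mul_comm, ← div_eq_mul_inv, ← edist_eq_enorm_sub,
    ← edist_eq_enorm_sub, ← mul_div_assoc]
  exact ENNReal.div_le_div_right (hF _ _) _

/-- The fundamental theorem of calculus along an absolutely continuous curve, for a Lipschitz
function vanishing outside a closed set. -/
theorem IsACq.enorm_sub_le {q : ℝ} (hq : 1 ≤ q) {γ : C(unitInterval, X)} (hγ : IsACq q γ)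
    {L : ℝ≥0} {F : X → ℝ} (hF : LipschitzWith L F) {K : Set X} (hK : IsClosed K)
    (hFK : ∀ x ∉ K, F x = 0) :
    ‖F (γ 1) - F (γ 0)‖ₑ ≤
      ∫⁻ s, K.indicator (fun _ => (L : ℝ≥0∞)) (γ s) * metricSpeed γ s := by
  have hac : AbsolutelyContinuousOnInterval (fun t => F (γ (projIcc 0 1 zero_le_one t))) 0 1 := by
    have h0 := hγ.absolutelyContinuousOnInterval hq
    unfold AbsolutelyContinuousOnInterval at h0 ⊢
    refine squeeze_zero (fun _ => Finset.sum_nonneg fun _ _ => dist_nonneg) (fun E => ?_)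
      (by simpa using h0.const_mul (L : ℝ))
    rw [Finset.mul_sum]
    exact Finset.sum_le_sum fun i _ => hF.dist_le_mul _ _
  have h1 := hac.enorm_sub_le_lintegral_deriv zero_le_one
  rw [← lintegral_unitInterval] at h1
  simp only [projIcc_left, projIcc_right] at h1
  exact h1.trans (lintegral_mono fun s => enorm_deriv_comp_projIcc_le hF hK hFK γ s)

end Curves

/-! ### Minimal gradients -/

/-- Every family of `[0, ∞]`-valued measurable functions has an essential infimum with respect to
a σ-finite measure. -/
theorem exists_essential_infimum {α : Type*} [MeasurableSpace α] (μ : Measure α) [SigmaFinite μ]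
    (S : Set (α → ℝ≥0∞)) (hS : ∀ G ∈ S, Measurable G) :
    ∃ N : α → ℝ≥0∞, Measurable N ∧ (∀ G ∈ S, N ≤ᵐ[μ] G) ∧
      ∀ H : α → ℝ≥0∞, (∀ G ∈ S, H ≤ᵐ[μ] G) → H ≤ᵐ[μ] N := by
  rcases S.eq_empty_or_nonempty with rfl | ⟨G₀, hG₀⟩
  · exact ⟨fun _ => ∞, measurable_const, by simp, fun H _ => .of_forall fun x => le_top⟩
  -- Countable infima are compared through one finite number: `y ↦ (1 + y)⁻¹` is strictly decreasing
  -- and bounded, and `μ.toFinite` is finite with the same null sets. The essential infimum is a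
  -- countable infimum maximizing `J`.
  let J : (ℕ → S) → ℝ≥0∞ := fun s => ∫⁻ x, (1 + ⨅ n, (s n : α → ℝ≥0∞) x)⁻¹ ∂μ.toFinite
  have hmeas (s : ℕ → S) : Measurable fun x => ⨅ n, (s n : α → ℝ≥0∞) x :=
    .iInf fun n => hS _ (s n).2
  have hJ (s : ℕ → S) : J s ≠ ∞ := by
    refine ne_top_of_le_ne_top (measure_ne_top μ.toFinite univ) ?_
    calc J s ≤ ∫⁻ _, 1 ∂μ.toFinite := lintegral_mono fun x => ENNReal.inv_le_one.2 le_self_add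
      _ = μ.toFinite univ := by simp
  obtain ⟨v, -, hv, hvm⟩ := exists_seq_tendsto_sSup (S := range J) ⟨_, ⟨fun _ => ⟨G₀, hG₀⟩, rfl⟩⟩
    (OrderTop.bddAbove _)
  choose s hs using hvm
  -- Unpairing merges all families of a maximizing sequence into one, which attains the supremum.
  let t : ℕ → S := fun n => s n.unpair.1 n.unpair.2
  have ht (s' : ℕ → S) : J s' ≤ J t := by
    refine (le_sSup (mem_range_self s')).trans (le_of_tendsto' hv fun k => ?_)
    rw [← hs k]
    refine lintegral_mono fun x => ENNReal.inv_le_inv.2 (add_le_add_right ?_ _)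
    refine le_iInf fun n => (iInf_le _ (Nat.pair k n)).trans_eq ?_
    simp [t]
  refine ⟨_, hmeas t, fun G hG => ?_, fun H hH => ?_⟩
  -- Adjoining `G` cannot increase the maximal `J`, so it leaves the infimum unchanged almost
  -- everywhere.
  · let t' : ℕ → S := fun n => Nat.casesOn n ⟨G, hG⟩ t
    have hle (x : α) : ⨅ n, (t' n).1 x ≤ ⨅ n, (t n).1 x :=
      le_iInf fun n => iInf_le (fun k => (t' k).1 x) (n + 1)
    have hae := ae_eq_of_ae_le_of_lintegral_le (μ := μ.toFinite)
      (.of_forall fun x => ENNReal.inv_le_inv.2 (add_le_add_right (hle x) 1)) (hJ t)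
      (measurable_const.add (hmeas t')).inv.aemeasurable (ht t')
    rw [EventuallyEq, ae_toFinite] at hae
    filter_upwards [hae] with x hx
    rw [inv_inj, ENNReal.add_right_inj ENNReal.one_ne_top] at hx
    rw [hx]
    exact iInf_le (fun n => (t' n).1 x) 0
  · filter_upwards [ae_all_iff.2 fun n => hH _ (t n).2] with x hx using le_iInf hx

section MetricMeasure

variable {X : Type*} [MetricSpace X] [MeasurableSpace X] {p : ℝ} {m : Measure X}
  {f g u v : X → ℝ} {G H : X → ℝ≥0∞}

theorem isMinimalGradient_minimalGradient [SigmaFinite m] (p : ℝ) (f : X → ℝ) :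
    IsMinimalGradient p m f (minimalGradient p m f) := by
  have h : ∃ G, IsMinimalGradient p m f G := by
    obtain ⟨N, hN, hle, hgr⟩ := exists_essential_infimum m {G | IsWeakUpperGradient p m f G}
      fun G hG => hG.measurable
    exact ⟨N, hN, hle, fun H _ hH => hgr H hH⟩
  rw [minimalGradient, dif_pos h]
  exact h.choose_spec

namespace IsWeakUpperGradient

theorem const_mul (h : IsWeakUpperGradient p m f G) (hp : 0 ≤ p) (c : ℝ) :
    IsWeakUpperGradient p m (fun x => c * f x) (fun x => ‖c‖ₑ * G x) where
  measurable := h.measurable.const_mul _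
  locInt K hK := by
    simp_rw [ENNReal.mul_rpow_of_nonneg _ _ hp]
    rw [lintegral_const_mul' _ _ (ENNReal.rpow_ne_top_of_nonneg hp enorm_ne_top)]
    exact ENNReal.mul_lt_top (ENNReal.rpow_lt_top_of_nonneg hp enorm_ne_top) (h.locInt K hK)
  upper q hq π hπ := by
    simp_rw [← mul_sub, enorm_mul, mul_assoc, lintegral_const_mul' _ _ (enorm_ne_top (x := c))]
    exact mul_le_mul' le_rfl (h.upper q hq π hπ)

theorem add [BorelSpace X] (h : IsWeakUpperGradient p m f G) (h' : IsWeakUpperGradient p m g H)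
    (hf : Measurable f) (hp : 1 ≤ p) :
    IsWeakUpperGradient p m (fun x => f x + g x) (fun x => G x + H x) where
  measurable := h.measurable.add h'.measurable
  locInt K hK := by
    refine (lintegral_mono fun x => ENNReal.rpow_add_le_mul_rpow_add_rpow (G x) (H x) hp).trans_lt ?_
    have h2 : (2 : ℝ≥0∞) ^ (p - 1) ≠ ∞ :=
      ENNReal.rpow_ne_top_of_nonneg (sub_nonneg.2 hp) ENNReal.ofNat_ne_top
    rw [lintegral_const_mul' _ _ h2, lintegral_add_left (h.measurable.pow_const p)]
    exact ENNReal.mul_lt_top h2.lt_top (ENNReal.add_lt_top.2 ⟨h.locInt K hK, h'.locInt K hK⟩)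
  upper q hq π hπ := by
    have hm : Measurable fun γ : C(unitInterval, X) => ‖f (γ 1) - f (γ 0)‖ₑ := by
      have he (t : unitInterval) : Measurable fun γ : C(unitInterval, X) => γ t :=
        (continuous_eval_const t).measurable
      exact ((hf.comp (he 1)).sub (hf.comp (he 0))).enorm
    calc ∫⁻ γ, ‖f (γ 1) + g (γ 1) - (f (γ 0) + g (γ 0))‖ₑ ∂π
        ≤ ∫⁻ γ, (‖f (γ 1) - f (γ 0)‖ₑ + ‖g (γ 1) - g (γ 0)‖ₑ) ∂π := by
          refine lintegral_mono fun γ => ?_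
          rw [add_sub_add_comm]
          exact enorm_add_le _ _
      _ = ∫⁻ γ, ‖f (γ 1) - f (γ 0)‖ₑ ∂π + ∫⁻ γ, ‖g (γ 1) - g (γ 0)‖ₑ ∂π :=
          lintegral_add_left hm _
      _ ≤ _ := add_le_add (h.upper q hq π hπ) (h'.upper q hq π hπ)
      -- Superadditivity of the lower integral needs no measurability of the metric speed.
      _ ≤ _ := le_lintegral_add _ _
      _ ≤ _ := by
          refine lintegral_mono fun γ => (le_lintegral_add _ _).trans (lintegral_mono fun s => ?_)
          rw [add_mul]

/-- The cutoff by `K` is what later makes the weak gradient of a test function vanish off its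
support. -/
theorem of_lipschitzWith [BorelSpace X] [IsFiniteMeasureOnCompacts m] (hp : 0 ≤ p) {L : ℝ≥0}
    (hf : LipschitzWith L f) {K : Set X} (hK : IsClosed K) (hfK : ∀ x ∉ K, f x = 0) :
    IsWeakUpperGradient p m f (K.indicator fun _ => (L : ℝ≥0∞)) where
  measurable := measurable_const.indicator hK.measurableSet
  locInt A hA := by
    refine (lintegral_mono (g := fun _ => (L : ℝ≥0∞) ^ p) fun x => ?_).trans_lt ?_
    · exact ENNReal.rpow_le_rpow (indicator_le_self' (fun _ _ => zero_le) x) hp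
    · rw [setLIntegral_const]
      exact ENNReal.mul_lt_top (ENNReal.rpow_lt_top_of_nonneg hp ENNReal.coe_ne_top)
        hA.measure_lt_top
  upper q hq π hπ := by
    refine lintegral_mono_ae ?_
    filter_upwards [hπ.ac] with γ hγ using hγ.enorm_sub_le hq.symm.lt.le hf hK hfK

end IsWeakUpperGradient

/-- The minimal gradient is only known as a greatest lower bound, not as a weak upper gradient
itself, so `N₁` and `N₂` cannot be inserted in `h`. Instead, for fixed `G₂`, the truncated
difference `(H - b G₂) / a` is below every `G₁`, hence below `N₁`; the same argument then replaces
`G₂` by `N₂`. -/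
theorem IsMinimalGradient.le_const_mul_add_const_mul {N₁ N₂ : X → ℝ≥0∞}
    (h₁ : IsMinimalGradient p m u N₁) (h₂ : IsMinimalGradient p m v N₂) (hH : Measurable H)
    {a b : ℝ≥0∞} (ha : a ≠ 0) (ha' : a ≠ ∞) (hb : b ≠ 0) (hb' : b ≠ ∞)
    (h : ∀ G₁ G₂, IsWeakUpperGradient p m u G₁ → IsWeakUpperGradient p m v G₂ →
      H ≤ᵐ[m] fun x => a * G₁ x + b * G₂ x) :
    H ≤ᵐ[m] fun x => a * N₁ x + b * N₂ x := by
  have aux {c : ℝ≥0∞} (hc : c ≠ 0) (hc' : c ≠ ∞) (x y z : ℝ≥0∞) :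
      (x - y) / c ≤ z ↔ x ≤ c * z + y := by
    rw [ENNReal.div_le_iff hc hc', tsub_le_iff_right, mul_comm z]
  have key (G₂) (hG₂ : IsWeakUpperGradient p m v G₂) :
      H ≤ᵐ[m] fun x => a * N₁ x + b * G₂ x := by
    have := h₁.greatest (fun x => (H x - b * G₂ x) / a)
      ((hH.sub (hG₂.measurable.const_mul b)).div_const a) fun G₁ hG₁ => by
        filter_upwards [h G₁ G₂ hG₁ hG₂] with x hx using (aux ha ha' _ _ _).2 hx
    filter_upwards [this] with x hx using (aux ha ha' _ _ _).1 hx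
  have := h₂.greatest (fun x => (H x - a * N₁ x) / b)
    ((hH.sub (h₁.measurable.const_mul a)).div_const b) fun G₂ hG₂ => by
      filter_upwards [key G₂ hG₂] with x hx
      exact (aux hb hb' _ _ _).2 (hx.trans_eq (add_comm _ _))
  filter_upwards [this] with x hx using ((aux hb hb' _ _ _).1 hx).trans_eq (add_comm _ _)

theorem MemSobolevLoc.const_mul_add_const_mul [BorelSpace X] (hp : 1 ≤ p) (hu : MemSobolevLoc p m u)
    (hv : MemSobolevLoc p m v) (s t : ℝ) : MemSobolevLoc p m fun x => s * u x + t * v x := by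
  obtain ⟨hum, G, hG⟩ := hu
  obtain ⟨hvm, H, hH⟩ := hv
  have hp0 : 0 ≤ p := zero_le_one.trans hp
  exact ⟨(hum.const_mul s).add (hvm.const_mul t), _,
    (hG.const_mul hp0 s).add (hH.const_mul hp0 t) (hum.const_mul s) hp⟩

variable [SigmaFinite m]

theorem minimalGradient_const_mul_add_const_mul_le [BorelSpace X] (hp : 1 ≤ p) (hu : Measurable u)
    {s t : ℝ} (hs : s ≠ 0) (ht : t ≠ 0) :
    minimalGradient p m (fun x => s * u x + t * v x) ≤ᵐ[m]
      fun x => ‖s‖ₑ * minimalGradient p m u x + ‖t‖ₑ * minimalGradient p m v x := by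
  have hp0 : 0 ≤ p := zero_le_one.trans hp
  have h := isMinimalGradient_minimalGradient (m := m) p (fun x => s * u x + t * v x)
  exact (isMinimalGradient_minimalGradient p u).le_const_mul_add_const_mul
    (isMinimalGradient_minimalGradient p v) h.measurable (enorm_ne_zero.2 hs) enorm_ne_top
    (enorm_ne_zero.2 ht) enorm_ne_top fun G₁ G₂ hG₁ hG₂ =>
      h.le _ ((hG₁.const_mul hp0 s).add (hG₂.const_mul hp0 t) (hu.const_mul s) hp)

theorem MemSobolevLoc.lintegral_minimalGradient_lt_top (hp : 0 ≤ p) (hu : MemSobolevLoc p m u)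
    {K : Set X} (hK : IsCompact K) : ∫⁻ x in K, minimalGradient p m u x ^ p ∂m < ∞ := by
  obtain ⟨-, G, hG⟩ := hu
  refine (lintegral_mono_ae (ae_restrict_of_ae ?_)).trans_lt (hG.locInt K hK)
  filter_upwards [(isMinimalGradient_minimalGradient p u).le G hG] with x hx
  exact ENNReal.rpow_le_rpow hx hp

theorem MemSobolevLoc.minimalGradient_lt_top [BorelSpace X] [SigmaCompactSpace X] (hp : 0 < p)
    (hu : MemSobolevLoc p m u) : ∀ᵐ x ∂m, minimalGradient p m u x < ∞ := by
  have hm := (isMinimalGradient_minimalGradient (m := m) p u).measurable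
  have h (n : ℕ) : ∀ᵐ x ∂m, x ∈ compactCovering X n → minimalGradient p m u x < ∞ := by
    have hK := isCompact_compactCovering X n
    rw [← ae_restrict_iff' hK.measurableSet]
    filter_upwards [ae_lt_top (hm.pow_const p)
      (hu.lintegral_minimalGradient_lt_top hp.le hK).ne] with x hx
    exact (ENNReal.rpow_lt_top_iff_of_pos hp).1 hx
  filter_upwards [ae_all_iff.2 h] with x hx
  obtain ⟨n, hn⟩ := exists_mem_compactCovering x
  exact hx n hn

end MetricMeasure

/-! ### Localized gradients -/

section MetricMeasure

variable {X : Type*} [MetricSpace X] {Ω : Set X}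

theorem isTest_zero (Ω : Set X) : IsTest Ω (fun _ => 0) :=
  ⟨⟨0, LipschitzWith.const 0⟩, HasCompactSupport.zero, by simp [tsupport]⟩

theorem IsTest.continuous {f : X → ℝ} (hf : IsTest Ω f) : Continuous f :=
  hf.1.choose_spec.continuous

theorem IsTest.const_mul_add_const_mul {f g : X → ℝ} (hf : IsTest Ω f) (hg : IsTest Ω g)
    (s t : ℝ) : IsTest Ω fun x => s * f x + t * g x := by
  obtain ⟨⟨K, hK⟩, hfc, hfs⟩ := hf
  obtain ⟨⟨L, hL⟩, hgc, hgs⟩ := hg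
  refine ⟨⟨_, ((lipschitzWith_smul s).comp hK).add ((lipschitzWith_smul t).comp hL)⟩,
    (hfc.mul_left (f := fun _ => s)).add (hgc.mul_left (f := fun _ => t)),
    (tsupport_add _ _).trans (union_subset ?_ ?_)⟩
  · exact (tsupport_mul_subset_right (f := fun _ => s)).trans hfs
  · exact (tsupport_mul_subset_right (f := fun _ => t)).trans hgs

theorem IsTest.const_mul {f : X → ℝ} (hf : IsTest Ω f) (s : ℝ) : IsTest Ω fun x => s * f x := by
  simpa using hf.const_mul_add_const_mul hf s 0

theorem IsTest.add {f g : X → ℝ} (hf : IsTest Ω f) (hg : IsTest Ω g) :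
    IsTest Ω fun x => f x + g x := by
  simpa using hf.const_mul_add_const_mul hg 1 1

theorem IsTest.mul {f g : X → ℝ} (hf : IsTest Ω f) (hg : IsTest Ω g) :
    ∃ L, LipschitzWith L fun x => f x * g x := by
  obtain ⟨A, hA⟩ := hf.2.1.exists_bound_of_continuous hf.continuous
  obtain ⟨B, hB⟩ := hg.2.1.exists_bound_of_continuous hg.continuous
  obtain ⟨⟨K, hK⟩, -⟩ := hf
  obtain ⟨⟨L, hL⟩, -⟩ := hg
  refine ⟨K * B.toNNReal + A.toNNReal * L, LipschitzWith.of_dist_le_mul fun x y => ?_⟩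
  have h1 := hK.dist_le_mul x y
  have h2 := hL.dist_le_mul x y
  rw [Real.dist_eq] at h1 h2 ⊢
  have e : f x * g x - f y * g y = (f x - f y) * g x + f y * (g x - g y) := by ring
  have hB' : |g x| ≤ B.toNNReal := (hB x).trans (Real.le_coe_toNNReal B)
  have hA' : |f y| ≤ A.toNNReal := (hA y).trans (Real.le_coe_toNNReal A)
  rw [e]
  refine (abs_add_le _ _).trans ?_
  rw [abs_mul, abs_mul]
  push_cast
  calc |f x - f y| * |g x| + |f y| * |g x - g y|
      ≤ (K * dist x y) * B.toNNReal + A.toNNReal * (L * dist x y) := by gcongr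
    _ = _ := by ring

theorem isCutoff_cutoffSeq (Ω : Set X) (n : ℕ) : IsCutoff Ω (cutoffSeq Ω n) := by
  unfold cutoffSeq
  split_ifs with h
  · exact h.choose_spec.1 n
  · exact ⟨isTest_zero Ω, fun x => by simp⟩

open Classical in
-- On a compact set only finitely many cutoffs enter `weakGradient`, so bounds for each of them
-- combine to a uniform one. If no cutoff sequence exists, `cutoffSeq` is zero and nothing is
-- claimed.
theorem exists_find_cutoffSeq_le {K : Set X} (hK : IsCompact K) (hKΩ : K ⊆ Ω) :
    ∃ N, ∀ x ∈ K, ∀ h : ∃ n, cutoffSeq Ω n x = 1, Nat.find h ≤ N := by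
  by_cases hχ : ∃ χ, IsCutoffSeq Ω χ; swap
  · refine ⟨0, fun x _ h => ?_⟩
    simp [cutoffSeq, hχ] at h
  have hcov : ∀ x ∈ Ω, ∃ n, ∀ᶠ y in 𝓝 x, cutoffSeq Ω n y = 1 := by
    rw [cutoffSeq, dif_pos hχ]
    exact hχ.choose_spec.2
  refine hK.induction_on (p := fun K => ∃ N, ∀ x ∈ K, ∀ h : ∃ n, cutoffSeq Ω n x = 1,
    Nat.find h ≤ N) ⟨0, by simp⟩ (fun s t hst ⟨N, hN⟩ => ⟨N, fun x hx => hN x (hst hx)⟩)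
    (fun s t ⟨N, hN⟩ ⟨M, hM⟩ => ⟨max N M, ?_⟩) fun x hx => ?_
  · rintro x (hx | hx) h
    · exact (hN x hx h).trans (le_max_left _ _)
    · exact (hM x hx h).trans (le_max_right _ _)
  · obtain ⟨n, hn⟩ := hcov x (hKΩ hx)
    exact ⟨_, mem_nhdsWithin_of_mem_nhds hn, n, fun y hy h => Nat.find_min' h hy⟩

variable [MeasurableSpace X] {p : ℝ} {m : Measure X} {f g u v : X → ℝ}

theorem weakGradient_nonneg (p : ℝ) (m : Measure X) (Ω : Set X) (f : X → ℝ) (x : X) :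
    0 ≤ weakGradient p m Ω f x := by
  unfold weakGradient
  split_ifs <;> simp

theorem MemSobolevLocOn.const_mul_add_const_mul [BorelSpace X] (hp : 1 ≤ p)
    (hu : MemSobolevLocOn p m Ω u) (hv : MemSobolevLocOn p m Ω v) (s t : ℝ) :
    MemSobolevLocOn p m Ω fun x => s * u x + t * v x := by
  constructor
  · have : Ω.indicator (fun x => s * u x + t * v x) =
        fun x => s * Ω.indicator u x + t * Ω.indicator v x := by
      ext x
      by_cases hx : x ∈ Ω <;> simp [hx]
    rw [this]
    exact (hu.1.const_mul s).add (hv.1.const_mul t)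
  · intro χ hχ
    convert (hu.2 χ hχ).const_mul_add_const_mul hp (hv.2 χ hχ) s t using 2
    ring

theorem IsTest.memSobolevLocOn [BorelSpace X] [IsFiniteMeasureOnCompacts m] (hp : 0 ≤ p)
    (hf : IsTest Ω f) : MemSobolevLocOn p m Ω f := by
  constructor
  · rw [indicator_eq_self.2 ((subset_tsupport f).trans hf.2.2)]
    exact hf.continuous.measurable
  · intro χ hχ
    obtain ⟨L, hL⟩ := hχ.1.mul hf
    exact ⟨hL.continuous.measurable, _,
      .of_lipschitzWith hp hL isClosed_univ fun x hx => (hx (mem_univ x)).elim⟩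

/-- Almost everywhere statements about the functions `|D(χₙ u)|_w` pass to `|Du|_w`. -/
theorem ae_weakGradient_of_forall {P : X → ℝ → ℝ → ℝ → Prop}
    (w : X → ℝ) (h0 : ∀ x, P x 0 0 0)
    (h : ∀ n, ∀ᵐ x ∂m, P x (minimalGradient p m (fun y => cutoffSeq Ω n y * u y) x).toReal
      (minimalGradient p m (fun y => cutoffSeq Ω n y * v y) x).toReal
      (minimalGradient p m (fun y => cutoffSeq Ω n y * w y) x).toReal) :
    ∀ᵐ x ∂m, P x (weakGradient p m Ω u x) (weakGradient p m Ω v x) (weakGradient p m Ω w x) := by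
  -- The index `Nat.find` depends on `x` and `Ω` only, so the three weak gradients at `x` use the
  -- same cutoff, and locality of minimal gradients is not needed. Where no cutoff equals `1`, all
  -- three are `0`.
  filter_upwards [ae_all_iff.2 h] with x hx
  unfold weakGradient
  split_ifs with hn
  · exact hx _
  · exact h0 x

variable [SigmaFinite m]

open Classical in
theorem measurable_weakGradient [BorelSpace X] (p : ℝ) (Ω : Set X) (f : X → ℝ) :
    Measurable (weakGradient p m Ω f) := by
  have hs (n : ℕ) : MeasurableSet {x | cutoffSeq Ω n x = 1} :=
    (isCutoff_cutoffSeq Ω n).1.continuous.measurable (measurableSet_singleton 1)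
  have hA : MeasurableSet {x | ∃ n, cutoffSeq Ω n x = 1} := by
    simpa only [ofPred_exists] using MeasurableSet.iUnion hs
  let N : {x | ∃ n, cutoffSeq Ω n x = 1} → ℕ := fun x => Nat.find x.2
  have hN : Measurable N := measurable_find _ fun n => measurable_subtype_coe (hs n)
  have hG : Measurable fun y : ℕ × {x | ∃ n, cutoffSeq Ω n x = 1} =>
      (minimalGradient p m (fun z => cutoffSeq Ω y.1 z * f z) y.2).toReal :=
    measurable_from_prod_countable_right fun n =>
      ((isMinimalGradient_minimalGradient (m := m) p
        fun z => cutoffSeq Ω n z * f z).measurable.comp measurable_subtype_coe).ennreal_toReal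
  exact Measurable.dite (hG.comp (hN.prodMk measurable_id)) measurable_const hA

/-- This seminorm inequality is the source of all convexity below. Zero coefficients are excluded
because the argument with greatest lower bounds divides by them. -/
theorem weakGradient_const_mul_add_const_mul_le [BorelSpace X] [SigmaCompactSpace X] (hp : 1 ≤ p)
    (hu : MemSobolevLocOn p m Ω u) (hv : MemSobolevLocOn p m Ω v) {s t : ℝ} (hs : s ≠ 0)
    (ht : t ≠ 0) :
    ∀ᵐ x ∂m, weakGradient p m Ω (fun y => s * u y + t * v y) x ≤
      |s| * weakGradient p m Ω u x + |t| * weakGradient p m Ω v x := by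
  refine ae_weakGradient_of_forall (P := fun x a b c => c ≤ |s| * a + |t| * b) _ (by simp)
    fun n => ?_
  have hu' := hu.2 _ (isCutoff_cutoffSeq Ω n)
  have hv' := hv.2 _ (isCutoff_cutoffSeq Ω n)
  have hp0 : 0 < p := zero_lt_one.trans_le hp
  have e : (fun y => cutoffSeq Ω n y * (s * u y + t * v y)) =
      fun y => s * (cutoffSeq Ω n y * u y) + t * (cutoffSeq Ω n y * v y) := by
    ext y; ring
  rw [e]
  filter_upwards [minimalGradient_const_mul_add_const_mul_le (m := m)
    (v := fun y => cutoffSeq Ω n y * v y) hp hu'.1 hs ht, hu'.minimalGradient_lt_top hp0,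
    hv'.minimalGradient_lt_top hp0] with x hx h1 h2
  have h3 := ENNReal.toReal_mono (ENNReal.add_ne_top.2
    ⟨ENNReal.mul_ne_top enorm_ne_top h1.ne, ENNReal.mul_ne_top enorm_ne_top h2.ne⟩) hx
  rwa [ENNReal.toReal_add (ENNReal.mul_ne_top enorm_ne_top h1.ne)
    (ENNReal.mul_ne_top enorm_ne_top h2.ne), ENNReal.toReal_mul, ENNReal.toReal_mul, toReal_enorm,
    toReal_enorm, Real.norm_eq_abs, Real.norm_eq_abs] at h3

/-- The weak gradient of a test function is bounded and vanishes outside its support. -/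
theorem IsTest.exists_weakGradient_le [BorelSpace X] [IsFiniteMeasureOnCompacts m] (hp : 0 ≤ p)
    (hf : IsTest Ω f) :
    ∃ M : ℝ, 0 ≤ M ∧
      ∀ᵐ x ∂m, weakGradient p m Ω f x ≤ (tsupport f).indicator (fun _ => M) x := by
  choose L hL using fun n => (isCutoff_cutoffSeq Ω n).1.mul hf
  obtain ⟨N, hN⟩ := exists_find_cutoffSeq_le hf.2.1 hf.2.2
  refine ⟨∑ n ∈ Finset.range (N + 1), (L n : ℝ), by positivity, ?_⟩
  have h (n : ℕ) : ∀ᵐ x ∂m, minimalGradient p m (fun y => cutoffSeq Ω n y * f y) x ≤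
      (tsupport f).indicator (fun _ => (L n : ℝ≥0∞)) x :=
    (isMinimalGradient_minimalGradient p _).le _ <|
      .of_lipschitzWith hp (hL n) (isClosed_tsupport f) fun x hx => by
        rw [image_eq_zero_of_notMem_tsupport hx, mul_zero]
  filter_upwards [ae_all_iff.2 h] with x hx
  unfold weakGradient
  split_ifs with hn; swap
  · exact indicator_nonneg (fun _ _ => by positivity) x
  have hx' := hx (Nat.find hn)
  by_cases hxK : x ∈ tsupport f
  · rw [indicator_of_mem hxK] at hx' ⊢
    refine (ENNReal.toReal_mono ENNReal.coe_ne_top hx').trans ?_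
    exact Finset.single_le_sum (f := fun n => (L n : ℝ)) (fun n _ => (L n).coe_nonneg)
      (Finset.mem_range.2 (Nat.lt_succ_of_le (hN x hxK hn)))
  · rw [indicator_of_notMem hxK] at hx' ⊢
    simp [le_zero_iff.1 hx']

theorem MemSobolevLocOn.memLp_weakGradient [BorelSpace X] (hp : 0 < p)
    (hu : MemSobolevLocOn p m Ω u) {K : Set X} (hK : IsCompact K) (hKΩ : K ⊆ Ω) :
    MemLp (weakGradient p m Ω u) (ENNReal.ofReal p) (m.restrict K) := by
  obtain ⟨N, hN⟩ := exists_find_cutoffSeq_le hK hKΩ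
  refine ⟨(measurable_weakGradient p Ω u).aestronglyMeasurable, ?_⟩
  rw [eLpNorm_lt_top_iff_lintegral_rpow_enorm_lt_top (by simpa using hp) ENNReal.ofReal_ne_top,
    ENNReal.toReal_ofReal hp.le]
  refine lt_of_le_of_lt (b := ∑ n ∈ Finset.range (N + 1),
    ∫⁻ x in K, minimalGradient p m (fun y => cutoffSeq Ω n y * u y) x ^ p ∂m) ?_ ?_
  · rw [← lintegral_finsetSum _ fun n _ =>
      (isMinimalGradient_minimalGradient p _).measurable.pow_const p]
    refine setLIntegral_mono' hK.measurableSet fun x hx => ?_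
    unfold weakGradient
    split_ifs with hn; swap
    · simp [hp]
    refine le_trans ?_ (Finset.single_le_sum
      (f := fun n => minimalGradient p m (fun y => cutoffSeq Ω n y * u y) x ^ p)
      (fun n _ => zero_le) (Finset.mem_range.2 (Nat.lt_succ_of_le (hN x hx hn))))
    refine ENNReal.rpow_le_rpow ?_ hp.le
    rw [Real.enorm_eq_ofReal ENNReal.toReal_nonneg]
    exact ENNReal.ofReal_toReal_le
  · exact ENNReal.sum_lt_top.2 fun n _ =>
      (hu.2 _ (isCutoff_cutoffSeq Ω n)).lintegral_minimalGradient_lt_top hp.le hK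

end MetricMeasure

/-! ### Directional derivatives -/

/-- The chain rule for `x ↦ x ^ p` at `a`: `p a^(p-1) r / (p a^(p-2)) = a r`. It removes the
exponent `p` from the quotients defining `D⁺`. -/
theorem tendsto_rpow_quotient {ι : Type*} {l : Filter ι} {w ε : ι → ℝ} {a r p : ℝ} (ha : 0 < a)
    (hp : p ≠ 0) (hw : Tendsto w l (𝓝 a)) (hr : Tendsto (fun i => (w i - a) / ε i) l (𝓝 r)) :
    Tendsto (fun i => (w i ^ p - a ^ p) / (p * ε i * a ^ (p - 2))) l (𝓝 (a * r)) := by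
  have hd : HasDerivAt (fun x : ℝ => x ^ p) (p * a ^ (p - 1)) a :=
    Real.hasDerivAt_rpow_const (Or.inl ha.ne')
  -- `dslope` equals the derivative on the diagonal, so indices with `w i = a` need no separate
  -- treatment.
  have hc := (continuousAt_dslope_same.2 hd.differentiableAt).tendsto.comp hw
  rw [dslope_same, hd.deriv] at hc
  have := (hr.mul hc).div_const (p * a ^ (p - 2))
  have e : r * (p * a ^ (p - 1)) / (p * a ^ (p - 2)) = a * r := by
    have hpos : 0 < a ^ (p - 2) := Real.rpow_pos_of_pos ha _
    rw [show p - 1 = (p - 2) + 1 by ring, Real.rpow_add ha, Real.rpow_one]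
    field_simp
  rw [e] at this
  refine this.congr fun i => ?_
  have h1 := sub_smul_dslope (fun x : ℝ => x ^ p) a (w i)
  simp only [smul_eq_mul] at h1
  rw [Function.comp_apply, div_mul_eq_mul_div, h1, div_div]
  congr 1
  ring

/-- Convexity makes the slopes from `0` monotone in `ε > 0`, and `-b` bounds them below. -/
theorem exists_tendsto_slope {w : ℚ → ℝ} {b : ℝ}
    (hconv : ∀ ε δ : ℚ, 0 < ε → ε < δ → w ε ≤ (1 - (ε : ℝ) / δ) * w 0 + ε / δ * w δ)
    (hb : ∀ ε : ℚ, |w ε - w 0| ≤ |(ε : ℝ)| * b) :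
    ∃ r, Tendsto (fun ε : ℚ => (w ε - w 0) / ε) (𝓝[>] 0) (𝓝 r) := by
  refine ⟨_, MonotoneOn.tendsto_nhdsGT ?_ ⟨-b, ?_⟩⟩
  · intro ε hε δ hδ hle
    rcases hle.eq_or_lt with rfl | hlt
    · exact le_rfl
    have hε' : (0 : ℝ) < ε := by exact_mod_cast hε
    have hδ' : (0 : ℝ) < δ := by exact_mod_cast hδ
    have h := hconv ε δ hε hlt
    simp only
    rw [div_le_iff₀ hε']
    calc w ε - w 0 ≤ (1 - (ε : ℝ) / δ) * w 0 + ε / δ * w δ - w 0 := by linarith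
      _ = _ := by ring
  · rintro _ ⟨ε, hε, rfl⟩
    have hε' : (0 : ℝ) < ε := by exact_mod_cast hε
    have h := (abs_le.1 (hb ε)).1
    simp only
    rw [le_div_iff₀ hε']
    rw [abs_of_pos hε'] at h
    linarith

/-- No boundedness is needed: `sInf` on `ℝ` is defined as `-sSup` of the negated set, so default
values match too. -/
theorem Real.limsup_neg {ι : Type*} (l : Filter ι) (u : ι → ℝ) :
    limsup (fun i => -u i) l = -liminf u l := by
  rw [limsup_eq, liminf_eq, Real.sInf_def]
  congr 2
  ext a
  simp

section MetricMeasure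

variable {X : Type*} [MetricSpace X] {Ω : Set X} [MeasurableSpace X] {p : ℝ} {m : Measure X}
  {f g u v : X → ℝ}

theorem gradQuotient_neg (p : ℝ) (m : Measure X) (Ω : Set X) (f g : X → ℝ) (ε : ℝ) (x : X) :
    gradQuotient p m Ω f g (-ε) x = -gradQuotient p m Ω (fun y => -f y) g ε x := by
  simp only [gradQuotient, neg_mul, mul_neg, div_neg]

/-- The substitution `ε ↦ -ε`. It holds at every point and reduces everything to `Dplus`. -/
theorem Dminus_eq_neg_Dplus (p : ℝ) (m : Measure X) (Ω : Set X) (f g : X → ℝ) (x : X) :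
    Dminus p m Ω f g x = -Dplus p m Ω (fun y => -f y) g x := by
  unfold Dminus Dplus
  split_ifs
  · simp
  have h : 𝓝[<] (0 : ℚ) = map (fun x => -x) (𝓝[>] 0) := by simp
  rw [← Real.limsup_neg, h, ← Filter.limsup_comp]
  congr 1
  ext ε
  simp [← gradQuotient_neg]

variable [BorelSpace X] [SigmaFinite m] [SigmaCompactSpace X]

theorem weakGradient_const_mul_le (hp : 1 ≤ p) (hf : MemSobolevLocOn p m Ω f) {t : ℝ}
    (ht : t ≠ 0) :
    ∀ᵐ x ∂m, weakGradient p m Ω (fun y => t * f y) x ≤ |t| * weakGradient p m Ω f x := by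
  -- Splitting `t f` into two halves deduces the one-function bound from the inequality for two
  -- nonzero coefficients.
  have ht' : t / 2 ≠ 0 := div_ne_zero ht two_ne_zero
  have h := weakGradient_const_mul_add_const_mul_le hp hf hf ht' ht'
  have e : (fun y => t / 2 * f y + t / 2 * f y) = fun y => t * f y := by ext; ring
  rw [e] at h
  filter_upwards [h] with x hx
  refine hx.trans_eq ?_
  rw [abs_div, abs_two]
  ring

theorem abs_weakGradient_add_mul_sub_le (hp : 1 ≤ p) (hg : MemSobolevLocOn p m Ω g)
    (hf : MemSobolevLocOn p m Ω f) (ε : ℝ) :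
    ∀ᵐ x ∂m, |weakGradient p m Ω (fun y => g y + ε * f y) x - weakGradient p m Ω g x| ≤
      |ε| * weakGradient p m Ω f x := by
  rcases eq_or_ne ε 0 with rfl | hε
  · simp
  have hgf : MemSobolevLocOn p m Ω (fun y => g y + ε * f y) := by
    simpa using hg.const_mul_add_const_mul hp hf 1 ε
  have h1 := weakGradient_const_mul_add_const_mul_le hp hg hf one_ne_zero hε
  have h2 := weakGradient_const_mul_add_const_mul_le hp hgf hf one_ne_zero (neg_ne_zero.2 hε)
  simp only [one_mul, abs_one, abs_neg] at h1 h2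
  have e : (fun y => g y + ε * f y + -ε * f y) = g := by ext; ring
  rw [e] at h2
  filter_upwards [h1, h2] with x h1 h2
  exact abs_le.2 ⟨by linarith, by linarith⟩

/-- The slopes of the convex function `ε ↦ |D(g + ε f)|_w` converge, so the lower limit is a limit.
As `ε` is rational, one null set serves for all the inequalities. Where `|Dg|_w = 0`, both sides
vanish. -/
theorem ae_tendsto_Dplus (hp : 1 ≤ p) (hg : MemSobolevLocOn p m Ω g)
    (hf : MemSobolevLocOn p m Ω f) :
    ∀ᵐ x ∂m, Tendsto (fun ε : ℚ => weakGradient p m Ω g x *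
      ((weakGradient p m Ω (fun y => g y + (ε : ℝ) * f y) x - weakGradient p m Ω g x) / ε))
      (𝓝[>] 0) (𝓝 (Dplus p m Ω f g x)) := by
  have hconv : ∀ ε δ : ℚ, 0 < ε → ε < δ → ∀ᵐ x ∂m,
      weakGradient p m Ω (fun y => g y + (ε : ℝ) * f y) x ≤
        (1 - (ε : ℝ) / δ) * weakGradient p m Ω g x +
          ε / δ * weakGradient p m Ω (fun y => g y + (δ : ℝ) * f y) x := by
    intro ε δ hε hδ
    have hε' : (0 : ℝ) < ε := by exact_mod_cast hε
    have hδ' : (ε : ℝ) < δ := by exact_mod_cast hδ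
    have hδ0 : (0 : ℝ) < δ := hε'.trans hδ'
    have h1 : 0 < (ε : ℝ) / δ := div_pos hε' hδ0
    have h2 : 0 < 1 - (ε : ℝ) / δ := sub_pos.2 ((div_lt_one hδ0).2 hδ')
    have hgf : MemSobolevLocOn p m Ω (fun y => g y + (δ : ℝ) * f y) := by
      simpa using hg.const_mul_add_const_mul hp hf 1 (δ : ℝ)
    have h := weakGradient_const_mul_add_const_mul_le hp hg hgf h2.ne' h1.ne'
    rw [abs_of_pos h1, abs_of_pos h2] at h
    have e : (fun y => (1 - (ε : ℝ) / δ) * g y + ε / δ * (g y + (δ : ℝ) * f y)) =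
        fun y => g y + (ε : ℝ) * f y := by
      ext y
      field_simp
      ring
    rwa [e] at h
  have hb := ae_all_iff.2 fun ε : ℚ => abs_weakGradient_add_mul_sub_le hp hg hf (ε : ℝ)
  have hconv' := ae_all_iff.2 fun ε : ℚ => ae_all_iff.2 fun δ : ℚ =>
    ae_all_iff.2 fun hε => ae_all_iff.2 fun hδ => hconv ε δ hε hδ
  filter_upwards [hb, hconv'] with x hb hconv
  by_cases h0 : weakGradient p m Ω g x = 0
  · simp [Dplus, h0]
  let w : ℚ → ℝ := fun ε => weakGradient p m Ω (fun y => g y + (ε : ℝ) * f y) x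
  have hw0 : w 0 = weakGradient p m Ω g x := by simp [w]
  obtain ⟨r, hr⟩ := exists_tendsto_slope (w := w) (b := weakGradient p m Ω f x)
    (by simpa only [hw0] using hconv) (by simpa only [hw0] using hb)
  rw [hw0] at hr
  have hc : Tendsto (fun ε : ℚ => (ε : ℝ)) (𝓝[>] 0) (𝓝 0) := by
    have : Tendsto (fun ε : ℚ => (ε : ℝ)) (𝓝 0) (𝓝 ((0 : ℚ) : ℝ)) :=
      Rat.continuous_coe_real.tendsto 0
    simpa using this.mono_left nhdsWithin_le_nhds
  have hw : Tendsto w (𝓝[>] 0) (𝓝 (weakGradient p m Ω g x)) := by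
    rw [tendsto_iff_dist_tendsto_zero]
    refine squeeze_zero (fun _ => dist_nonneg) (fun ε => ?_)
      (by simpa using hc.abs.mul_const (weakGradient p m Ω f x))
    rw [Real.dist_eq]
    exact hb ε
  have hq := tendsto_rpow_quotient (lt_of_le_of_ne (weakGradient_nonneg p m Ω g x) (Ne.symm h0))
    (zero_lt_one.trans_le hp).ne' hw hr
  have hD : Dplus p m Ω f g x = weakGradient p m Ω g x * r := by
    rw [Dplus, if_neg h0]
    exact hq.liminf_eq
  rw [hD]
  exact hr.const_mul _

theorem ae_abs_Dplus_le (hp : 1 ≤ p) (hg : MemSobolevLocOn p m Ω g)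
    (hf : MemSobolevLocOn p m Ω f) :
    ∀ᵐ x ∂m, |Dplus p m Ω f g x| ≤ weakGradient p m Ω g x * weakGradient p m Ω f x := by
  filter_upwards [ae_tendsto_Dplus hp hg hf,
    ae_all_iff.2 fun ε : ℚ => abs_weakGradient_add_mul_sub_le hp hg hf (ε : ℝ)] with x hx hb
  refine le_of_tendsto hx.abs (eventually_nhdsWithin_of_forall fun ε hε => ?_)
  have hε' : (0 : ℝ) < ε := by exact_mod_cast hε
  rw [abs_mul, abs_of_nonneg (weakGradient_nonneg p m Ω g x), abs_div]
  refine mul_le_mul_of_nonneg_left ?_ (weakGradient_nonneg p m Ω g x)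
  rw [div_le_iff₀ (abs_pos.2 hε'.ne'), mul_comm]
  exact hb ε

theorem tendsto_const_mul_nhdsGT_zero {𝕜 : Type*} [Field 𝕜] [LinearOrder 𝕜] [IsStrictOrderedRing 𝕜]
    [TopologicalSpace 𝕜] [OrderTopology 𝕜] {c : 𝕜} (hc : 0 < c) :
    Tendsto (fun x => c * x) (𝓝[>] 0) (𝓝[>] 0) := by
  refine tendsto_nhdsWithin_iff.2 ⟨?_, eventually_nhdsWithin_of_forall fun x hx => mul_pos hc hx⟩
  have : Tendsto (fun x => c * x) (𝓝 0) (𝓝 (c * 0)) := (continuous_const_mul c).tendsto 0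
  rw [mul_zero] at this
  exact this.mono_left nhdsWithin_le_nhds

/-- Substituting `c ε` for `ε` in the limit requires `c` to be rational, like `ε`. -/
theorem Dplus_const_mul (hp : 1 ≤ p) (hg : MemSobolevLocOn p m Ω g)
    (hf : MemSobolevLocOn p m Ω f) {c : ℚ} (hc : 0 < c) :
    ∀ᵐ x ∂m, Dplus p m Ω (fun y => (c : ℝ) * f y) g x = c * Dplus p m Ω f g x := by
  have hcf : MemSobolevLocOn p m Ω (fun y => (c : ℝ) * f y) := by
    simpa using hf.const_mul_add_const_mul hp hf (c : ℝ) 0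
  filter_upwards [ae_tendsto_Dplus hp hg hf, ae_tendsto_Dplus hp hg hcf] with x h1 h2
  refine tendsto_nhds_unique h2
    (((h1.comp (tendsto_const_mul_nhdsGT_zero hc)).const_mul (c : ℝ)).congr fun ε => ?_)
  have e : (fun y => g y + ((c * ε : ℚ) : ℝ) * f y) = fun y => g y + (ε : ℝ) * (c * f y) := by
    ext y
    push_cast
    ring
  have hc' : (c : ℝ) ≠ 0 := by exact_mod_cast hc.ne'
  simp only [Function.comp_apply, e]
  push_cast
  rw [mul_left_comm, div_mul_eq_div_div_swap, mul_div_cancel₀ _ hc']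

/-- `g + ε (u + v)` is the midpoint of `g + 2ε u` and `g + 2ε v`; the factor `2` cancels in the
slopes. -/
theorem Dplus_add_le (hp : 1 ≤ p) (hg : MemSobolevLocOn p m Ω g)
    (hu : MemSobolevLocOn p m Ω u) (hv : MemSobolevLocOn p m Ω v) :
    ∀ᵐ x ∂m, Dplus p m Ω (fun y => u y + v y) g x ≤
      Dplus p m Ω u g x + Dplus p m Ω v g x := by
  have huv : MemSobolevLocOn p m Ω (fun y => u y + v y) := by
    simpa using hu.const_mul_add_const_mul hp hv 1 1
  have hW : ∀ ε : ℚ, ∀ᵐ x ∂m, weakGradient p m Ω (fun y => g y + (ε : ℝ) * (u y + v y)) x ≤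
      (weakGradient p m Ω (fun y => g y + ((2 * ε : ℚ) : ℝ) * u y) x +
        weakGradient p m Ω (fun y => g y + ((2 * ε : ℚ) : ℝ) * v y) x) / 2 := by
    intro ε
    have hmem {w} (hw : MemSobolevLocOn p m Ω w) :
        MemSobolevLocOn p m Ω (fun y => g y + ((2 * ε : ℚ) : ℝ) * w y) := by
      simpa using hg.const_mul_add_const_mul hp hw 1 ((2 * ε : ℚ) : ℝ)
    have h := weakGradient_const_mul_add_const_mul_le hp (hmem hu) (hmem hv)
      (s := 1 / 2) (t := 1 / 2) (by norm_num) (by norm_num)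
    have e : (fun y => 1 / 2 * (g y + ((2 * ε : ℚ) : ℝ) * u y) +
        1 / 2 * (g y + ((2 * ε : ℚ) : ℝ) * v y)) = fun y => g y + (ε : ℝ) * (u y + v y) := by
      ext y
      push_cast
      ring
    rw [e, abs_of_pos (by norm_num)] at h
    filter_upwards [h] with x hx
    linarith
  filter_upwards [ae_tendsto_Dplus hp hg hu, ae_tendsto_Dplus hp hg hv,
    ae_tendsto_Dplus hp hg huv, ae_all_iff.2 hW] with x h1 h2 h3 hW
  have h2' := tendsto_const_mul_nhdsGT_zero (𝕜 := ℚ) two_pos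
  refine le_of_tendsto_of_tendsto h3 ((h1.comp h2').add (h2.comp h2'))
    (eventually_nhdsWithin_of_forall fun ε hε => ?_)
  have hε' : (0 : ℝ) < ε := by exact_mod_cast hε
  simp only [Function.comp_apply]
  rw [← mul_add]
  refine mul_le_mul_of_nonneg_left ?_ (weakGradient_nonneg p m Ω g x)
  rw [← add_div, div_le_div_iff₀ hε' (by push_cast; positivity)]
  have := mul_le_mul_of_nonneg_right (hW ε) hε'.le
  push_cast at this ⊢
  nlinarith

theorem aemeasurable_Dplus (hp : 1 ≤ p) (hg : MemSobolevLocOn p m Ω g)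
    (hf : MemSobolevLocOn p m Ω f) : AEMeasurable (Dplus p m Ω f g) m := by
  let ε : ℕ → ℚ := fun n => 1 / (n + 1)
  have hε : Tendsto ε atTop (𝓝[>] 0) := by
    refine tendsto_nhdsWithin_iff.2 ⟨?_, .of_forall fun n => by simp only [ε, mem_Ioi]; positivity⟩
    exact tendsto_one_div_add_atTop_nhds_zero_nat
  refine aemeasurable_of_tendsto_metrizable_ae atTop (f := fun n x => weakGradient p m Ω g x *
    ((weakGradient p m Ω (fun y => g y + (ε n : ℝ) * f y) x - weakGradient p m Ω g x) / ε n))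
    (fun n => ?_) ?_
  · have hm (u : X → ℝ) := measurable_weakGradient (m := m) p Ω u
    exact ((hm g).mul (((hm _).sub (hm g)).div_const _)).aemeasurable
  · filter_upwards [ae_tendsto_Dplus hp hg hf] with x hx using hx.comp hε

end MetricMeasure

/-! ### The sublinear functional defining the divergence -/

/-- A subadditive function that is homogeneous for positive rational factors, and bounded on each
line, is homogeneous for positive real factors. -/
theorem map_smul_of_subadditive_of_rat {E : Type*} [AddCommGroup E] [Module ℝ E] {T : E → ℝ}
    (hadd : ∀ x y, T (x + y) ≤ T x + T y) {x : E} {C : ℝ}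
    (hrat : ∀ c : ℚ, 0 < c → T ((c : ℝ) • x) = c * T x) (hC : ∀ t : ℝ, |T (t • x)| ≤ |t| * C)
    {c : ℝ} (hc : 0 < c) : T (c • x) = c * T x := by
  have hC0 : 0 ≤ C := by simpa using (abs_nonneg _).trans (hC 1)
  rw [← sub_eq_zero, ← abs_eq_zero]
  refine le_antisymm (le_of_forall_pos_le_add fun η hη => ?_) (abs_nonneg _)
  have hpos : 0 < C + |T x| + 1 := by positivity
  -- The first bound makes `r` positive; the second keeps the errors of replacing `c` by `r` below
  -- `η`.
  obtain ⟨r, hr⟩ := exists_rat_near c (lt_min hc (div_pos hη hpos))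
  have hr0 : 0 < r := by
    have := (le_abs_self _).trans_lt (hr.trans_le (min_le_left _ _))
    exact_mod_cast (by linarith : (0 : ℝ) < r)
  have h1 : T (c • x) ≤ r * T x + |c - r| * C := by
    have := hadd ((r : ℝ) • x) ((c - r) • x)
    rw [← add_smul, add_sub_cancel, hrat r hr0] at this
    linarith [(le_abs_self _).trans (hC (c - r))]
  have h2 : r * T x ≤ T (c • x) + |c - r| * C := by
    have := hadd (c • x) ((r - c) • x)
    rw [← add_smul, add_sub_cancel, hrat r hr0] at this
    rw [abs_sub_comm]
    linarith [(le_abs_self _).trans (hC (r - c))]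
  have h3 : |(c - r) * T x| ≤ |c - r| * |T x| := (abs_mul _ _).le
  have h4 : |c - r| * (C + |T x| + 1) ≤ η :=
    ((lt_div_iff₀ hpos).1 (hr.trans_le (min_le_right _ _))).le
  have h5 := abs_le.1 h3
  have h6 := abs_nonneg (c - r)
  rw [zero_add, abs_le]
  constructor <;> nlinarith

section MetricMeasure

variable {X : Type*} [MetricSpace X] {Ω : Set X}

theorem IsTest.neg {f : X → ℝ} (hf : IsTest Ω f) : IsTest Ω fun x => -f x := by
  simpa using hf.const_mul (-1)

/-- The space of test functions. -/
def testSubmodule (Ω : Set X) : Submodule ℝ (X → ℝ) where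
  carrier := {f | IsTest Ω f}
  zero_mem' := isTest_zero Ω
  add_mem' hf hg := hf.add hg
  smul_mem' c _ hf := hf.const_mul c

variable [MeasurableSpace X] {p q : ℝ} {m : Measure X} {f g u v k h : X → ℝ}

/-- The weights `h⁻` and `h⁺` are nonnegative, so sublinearity of `D⁺` in `f` passes to the
integrand. -/
theorem neg_Dsign_neg_mul (p : ℝ) (m : Measure X) (Ω : Set X) (f g : X → ℝ) (s : ℝ) (x : X) :
    -(Dsign p m Ω (-s) f g x * s) =
      max (-s) 0 * Dplus p m Ω f g x + max s 0 * Dplus p m Ω (fun y => -f y) g x := by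
  unfold Dsign
  split_ifs with hs
  · rw [max_eq_left hs.le, max_eq_right (by linarith)]
    ring
  · rw [max_eq_right (by linarith), max_eq_left (by linarith), Dminus_eq_neg_Dplus]
    ring

theorem Dsign_mul (p : ℝ) (m : Measure X) (Ω : Set X) (f g : X → ℝ) (s : ℝ) (x : X) :
    Dsign p m Ω s f g x * s = -(Dsign p m Ω (-s) (fun y => -f y) g x * s) := by
  rcases lt_trichotomy s 0 with hs | rfl | hs
  · simp [Dsign, hs, hs.not_gt, Dminus_eq_neg_Dplus]
  · simp
  · simp [Dsign, hs, hs.not_gt, Dminus_eq_neg_Dplus]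

/-- The functional `f ↦ -∫ D^{-sign h}f(∇g) h dm`. -/
noncomputable def divUpper (p : ℝ) (m : Measure X) (Ω : Set X) (h g f : X → ℝ) : ℝ :=
  -∫ x in Ω, Dsign p m Ω (-h x) f g x * h x ∂m

theorem divUpper_eq (p : ℝ) (m : Measure X) (Ω : Set X) (h g f : X → ℝ) :
    divUpper p m Ω h g f = ∫ x in Ω, (max (-h x) 0 * Dplus p m Ω f g x +
      max (h x) 0 * Dplus p m Ω (fun y => -f y) g x) ∂m := by
  rw [divUpper, ← integral_neg]
  simp only [neg_Dsign_neg_mul]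

/-- The lower bound for a divergence at `f` is the upper bound at `-f`, so for a linear functional
the upper bound suffices. -/
theorem neg_integral_Dsign_mul (p : ℝ) (m : Measure X) (Ω : Set X) (h g f : X → ℝ) :
    -∫ x in Ω, Dsign p m Ω (h x) f g x * h x ∂m = -divUpper p m Ω h g (fun y => -f y) := by
  rw [divUpper]
  simp only [Dsign_mul p m Ω f, integral_neg]

theorem MemLpLocOn.neg (hh : MemLpLocOn q m Ω h) : MemLpLocOn q m Ω fun x => -h x :=
  fun K hK hKΩ => (hh K hK hKΩ).neg

theorem MemLpLocOn.max_zero (hh : MemLpLocOn q m Ω h) : MemLpLocOn q m Ω fun x => max (h x) 0 :=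
  fun K hK hKΩ => (hh K hK hKΩ).pos_part

variable [BorelSpace X] [SigmaFinite m] [IsFiniteMeasureOnCompacts m]

theorem IsTest.ae_weakGradient_eq_zero (hp : 0 ≤ p) (hf : IsTest Ω f) :
    ∀ᵐ x ∂m, x ∉ tsupport f → weakGradient p m Ω f x = 0 := by
  obtain ⟨M, -, hM⟩ := hf.exists_weakGradient_le (m := m) hp
  filter_upwards [hM] with x hx hxf
  rw [indicator_of_notMem hxf] at hx
  exact hx.antisymm (weakGradient_nonneg p m Ω f x)

/-- Hölder for `k ∈ L^q` and `|Dg|_w ∈ L^p` on the compact support of `f`, where `|Df|_w` is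
bounded; outside it `|Df|_w` vanishes. -/
theorem integrableOn_mul_weakGradient (hpq : p.HolderConjugate q) (hΩ : MeasurableSet Ω)
    (hg : MemSobolevLocOn p m Ω g) (hk : MemLpLocOn q m Ω k) (hf : IsTest Ω f) :
    IntegrableOn (fun x => |k x| * (weakGradient p m Ω g x * weakGradient p m Ω f x)) Ω m := by
  obtain ⟨M, hM0, hM⟩ := hf.exists_weakGradient_le (m := m) hpq.nonneg
  have hK : IsCompact (tsupport f) := hf.2.1
  refine IntegrableOn.of_ae_sdiff_eq_zero (s := tsupport f) ?_ hΩ.nullMeasurableSet ?_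
  · have hkK := hk _ hK hf.2.2
    have hgK := hg.memLp_weakGradient hpq.pos hK hf.2.2
    have : ENNReal.HolderTriple (ENNReal.ofReal q) (ENNReal.ofReal p) 1 :=
      hpq.symm.ennrealOfReal
    have hi := (hkK.integrable_mul hgK).norm.mul_const M
    refine hi.mono' ?_ ?_
    · exact hkK.1.norm.mul ((measurable_weakGradient p Ω g).mul
        (measurable_weakGradient p Ω f)).aestronglyMeasurable
    · filter_upwards [ae_restrict_of_ae hM] with x hx
      have h1 := weakGradient_nonneg p m Ω g x
      have h2 := weakGradient_nonneg p m Ω f x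
      have h3 : weakGradient p m Ω f x ≤ M := hx.trans (indicator_le_self' (fun _ _ => hM0) x)
      simp only [Pi.mul_apply, norm_mul, Real.norm_eq_abs, abs_abs, abs_of_nonneg h1,
        abs_of_nonneg h2]
      rw [← mul_assoc]
      gcongr
  · filter_upwards [hf.ae_weakGradient_eq_zero (m := m) hpq.nonneg] with x hx hx'
    rw [hx hx'.2, mul_zero, mul_zero]

variable [SigmaCompactSpace X]

theorem integrableOn_mul_Dplus (hpq : p.HolderConjugate q) (hΩ : MeasurableSet Ω)
    (hg : MemSobolevLocOn p m Ω g) (hk : MemLpLocOn q m Ω k) (hf : IsTest Ω f) :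
    IntegrableOn (fun x => k x * Dplus p m Ω f g x) Ω m := by
  have hf' : MemSobolevLocOn p m Ω f := hf.memSobolevLocOn hpq.nonneg
  have hb := ae_abs_Dplus_le hpq.lt.le hg hf'
  refine IntegrableOn.of_ae_sdiff_eq_zero (s := tsupport f) ?_ hΩ.nullMeasurableSet ?_
  · refine Integrable.mono'
      ((integrableOn_mul_weakGradient hpq hΩ hg hk hf).mono_set hf.2.2) ?_ ?_
    · exact (hk _ hf.2.1 hf.2.2).1.mul
        (aemeasurable_Dplus hpq.lt.le hg hf').aestronglyMeasurable.restrict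
    · filter_upwards [ae_restrict_of_ae hb] with x hx
      rw [norm_mul, Real.norm_eq_abs, Real.norm_eq_abs]
      gcongr
  · filter_upwards [hf.ae_weakGradient_eq_zero (m := m) hpq.nonneg, hb] with x hx hb hx'
    rw [hx hx'.2, mul_zero] at hb
    rw [abs_nonpos_iff.1 hb, mul_zero]

theorem divUpper_eq_add (hpq : p.HolderConjugate q) (hΩ : MeasurableSet Ω)
    (hg : MemSobolevLocOn p m Ω g) (hh : MemLpLocOn q m Ω h) (hf : IsTest Ω f) :
    divUpper p m Ω h g f = ∫ x in Ω, max (-h x) 0 * Dplus p m Ω f g x ∂m +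
      ∫ x in Ω, max (h x) 0 * Dplus p m Ω (fun y => -f y) g x ∂m := by
  rw [divUpper_eq]
  exact integral_add (integrableOn_mul_Dplus hpq hΩ hg hh.neg.max_zero hf)
    (integrableOn_mul_Dplus hpq hΩ hg hh.max_zero hf.neg)

theorem divUpper_add_le (hpq : p.HolderConjugate q) (hΩ : MeasurableSet Ω)
    (hg : MemSobolevLocOn p m Ω g) (hh : MemLpLocOn q m Ω h) (hu : IsTest Ω u)
    (hv : IsTest Ω v) :
    divUpper p m Ω h g (fun x => u x + v x) ≤ divUpper p m Ω h g u + divUpper p m Ω h g v := by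
  have key {k u v : X → ℝ} (hk : MemLpLocOn q m Ω k) (hk0 : ∀ x, 0 ≤ k x) (hu : IsTest Ω u)
      (hv : IsTest Ω v) : ∫ x in Ω, k x * Dplus p m Ω (fun y => u y + v y) g x ∂m ≤
        ∫ x in Ω, k x * Dplus p m Ω u g x ∂m + ∫ x in Ω, k x * Dplus p m Ω v g x ∂m := by
    have hiu := integrableOn_mul_Dplus hpq hΩ hg hk hu
    have hiv := integrableOn_mul_Dplus hpq hΩ hg hk hv
    rw [← integral_add hiu hiv]
    refine integral_mono_ae (integrableOn_mul_Dplus hpq hΩ hg hk (hu.add hv)) (hiu.add hiv)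
      (ae_restrict_of_ae ?_)
    filter_upwards [Dplus_add_le hpq.lt.le hg (hu.memSobolevLocOn hpq.nonneg)
      (hv.memSobolevLocOn hpq.nonneg)] with x hx
    refine le_trans ?_ (mul_add (k x) _ _).le
    exact mul_le_mul_of_nonneg_left hx (hk0 x)
  rw [divUpper_eq_add hpq hΩ hg hh hu, divUpper_eq_add hpq hΩ hg hh hv,
    divUpper_eq_add hpq hΩ hg hh (hu.add hv)]
  have h1 := key hh.neg.max_zero (fun x => le_max_right _ _) hu hv
  have h2 := key hh.max_zero (fun x => le_max_right _ _) hu.neg hv.neg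
  simp only [neg_add]
  linarith

theorem divUpper_rat_mul (hpq : p.HolderConjugate q) (hg : MemSobolevLocOn p m Ω g)
    (hf : IsTest Ω f) {c : ℚ} (hc : 0 < c) :
    divUpper p m Ω h g (fun x => (c : ℝ) * f x) = c * divUpper p m Ω h g f := by
  rw [divUpper_eq, divUpper_eq, ← integral_const_mul]
  refine integral_congr_ae (ae_restrict_of_ae ?_)
  filter_upwards [Dplus_const_mul hpq.lt.le hg (hf.memSobolevLocOn (m := m) hpq.nonneg) hc,
    Dplus_const_mul hpq.lt.le hg (hf.neg.memSobolevLocOn (m := m) hpq.nonneg) hc] with x h1 h2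
  simp only [mul_neg] at h2
  rw [h1, h2]
  ring

theorem exists_abs_divUpper_le (hpq : p.HolderConjugate q) (hΩ : MeasurableSet Ω)
    (hg : MemSobolevLocOn p m Ω g) (hh : MemLpLocOn q m Ω h) (hf : IsTest Ω f) :
    ∃ C, ∀ t : ℝ, |divUpper p m Ω h g (fun x => t * f x)| ≤ |t| * C := by
  have key {k f : X → ℝ} (hk : MemLpLocOn q m Ω k) (hf : IsTest Ω f) {t : ℝ} (ht : t ≠ 0) :
      |∫ x in Ω, k x * Dplus p m Ω (fun y => t * f y) g x ∂m| ≤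
        |t| * ∫ x in Ω, |k x| * (weakGradient p m Ω g x * weakGradient p m Ω f x) ∂m := by
    have hf' : MemSobolevLocOn p m Ω f := hf.memSobolevLocOn hpq.nonneg
    rw [← integral_const_mul, ← Real.norm_eq_abs]
    refine norm_integral_le_of_norm_le
      ((integrableOn_mul_weakGradient hpq hΩ hg hk hf).const_mul _) (ae_restrict_of_ae ?_)
    filter_upwards [ae_abs_Dplus_le hpq.lt.le hg
      ((hf.const_mul t).memSobolevLocOn hpq.nonneg), weakGradient_const_mul_le hpq.lt.le hf' ht]
      with x h1 h2
    rw [norm_mul, Real.norm_eq_abs, Real.norm_eq_abs]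
    have h3 := weakGradient_nonneg p m Ω g x
    calc |k x| * |Dplus p m Ω (fun y => t * f y) g x|
        ≤ |k x| * (weakGradient p m Ω g x * (|t| * weakGradient p m Ω f x)) := by
          gcongr
          exact h1.trans (by gcongr)
      _ = _ := by ring
  refine ⟨∫ x in Ω, |max (-h x) 0| * (weakGradient p m Ω g x * weakGradient p m Ω f x) ∂m +
    ∫ x in Ω, |max (h x) 0| *
      (weakGradient p m Ω g x * weakGradient p m Ω (fun y => -f y) x) ∂m, fun t => ?_⟩
  rcases eq_or_ne t 0 with rfl | ht
  -- At `t = 0` the value is zero because it equals twice itself.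
  · have := divUpper_rat_mul (m := m) (h := h) hpq hg (isTest_zero Ω) (c := 2) two_pos
    simp only [mul_zero, zero_mul, abs_zero] at this ⊢
    rw [show divUpper p m Ω h g (fun _ => 0) = 0 by push_cast at this; linarith, abs_zero]
  · rw [divUpper_eq_add hpq hΩ hg hh (hf.const_mul t), mul_add]
    refine (abs_add_le _ _).trans (add_le_add (key hh.neg.max_zero hf ht) ?_)
    simp only [← mul_neg]
    exact key hh.max_zero hf.neg ht

/-- A linear functional below `divUpper`. -/
theorem exists_linearMap_le_divUpper (hpq : p.HolderConjugate q) (hΩ : MeasurableSet Ω)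
    (hg : MemSobolevLocOn p m Ω g) (hh : MemLpLocOn q m Ω h) :
    ∃ L : testSubmodule Ω →ₗ[ℝ] ℝ, ∀ f : testSubmodule Ω, L f ≤ divUpper p m Ω h g f := by
  have hadd (u v : testSubmodule Ω) : divUpper p m Ω h g ((u + v : testSubmodule Ω) : X → ℝ) ≤
      divUpper p m Ω h g u + divUpper p m Ω h g v := divUpper_add_le hpq hΩ hg hh u.2 v.2
  have hsmul (c : ℝ) (hc : 0 < c) (u : testSubmodule Ω) :
      divUpper p m Ω h g ((c • u : testSubmodule Ω) : X → ℝ) = c * divUpper p m Ω h g u := by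
    obtain ⟨C, hC⟩ := exists_abs_divUpper_le hpq hΩ hg hh u.2
    exact map_smul_of_subadditive_of_rat (T := fun u : testSubmodule Ω => divUpper p m Ω h g u)
      hadd (fun c hc => divUpper_rat_mul hpq hg u.2 hc) hC hc
  have h0 : 0 ≤ divUpper p m Ω h g ((0 : testSubmodule Ω) : X → ℝ) := by
    have := hsmul 2 two_pos 0
    rw [smul_zero] at this
    linarith
  -- Hahn–Banach, extending the zero functional on the zero subspace.
  obtain ⟨L, -, hL⟩ := exists_extension_of_le_sublinear (⊥ : testSubmodule Ω →ₗ.[ℝ] ℝ)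
    (fun u => divUpper p m Ω h g u) hsmul hadd fun x => by
      have hx : x = 0 := Subtype.ext ((Submodule.mem_bot ℝ).1 x.2)
      rw [hx]
      simpa using h0
  exact ⟨L, hL⟩

end MetricMeasure

/-! ### Doubling spaces are proper -/

section Doubling

variable {X : Type*} [MetricSpace X] [MeasurableSpace X] {m : Measure X}

theorem IsDoubling.exists_measure_ball_two_pow_le (h : IsDoubling m) :
    ∃ C : ℝ≥0, ∀ (n : ℕ) (x : X) (r : ℝ), 0 < r →
      m (Metric.ball x (2 ^ n * r)) ≤ C ^ n * m (Metric.ball x r) := by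
  obtain ⟨C, hC⟩ := h
  refine ⟨C, fun n x r hr => ?_⟩
  induction n with
  | zero => simp
  | succ n ih =>
    rw [pow_succ', mul_assoc, pow_succ', mul_assoc]
    exact (hC x _ (by positivity)).trans (mul_le_mul' le_rfl ih)

theorem IsDoubling.measure_ball_lt_top [IsLocallyFiniteMeasure m] (h : IsDoubling m) (x : X)
    (r : ℝ) : m (Metric.ball x r) < ∞ := by
  obtain ⟨C, hC⟩ := h.exists_measure_ball_two_pow_le
  obtain ⟨ε, hε, hlt⟩ := Metric.nhds_basis_ball.mem_iff.1
    ((m.finiteAt_nhds x).exists_mem_basis (𝓝 x).basis_sets).choose_spec.1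
  have hfin := ((m.finiteAt_nhds x).exists_mem_basis (𝓝 x).basis_sets).choose_spec.2
  obtain ⟨n, hn⟩ := pow_unbounded_of_one_lt (r / ε) one_lt_two
  calc m (Metric.ball x r) ≤ m (Metric.ball x (2 ^ n * ε)) :=
        measure_mono (Metric.ball_subset_ball ((div_lt_iff₀ hε).1 hn).le)
    _ ≤ C ^ n * m (Metric.ball x ε) := hC n x ε hε
    _ < ∞ := ENNReal.mul_lt_top (ENNReal.pow_lt_top ENNReal.coe_lt_top)
        ((measure_mono hlt).trans_lt hfin)

theorem IsDoubling.measure_ball_pos (h : IsDoubling m) (hm : m ≠ 0) (x : X) {r : ℝ}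
    (hr : 0 < r) : 0 < m (Metric.ball x r) := by
  obtain ⟨C, hC⟩ := h.exists_measure_ball_two_pow_le
  refine pos_iff_ne_zero.2 fun h0 => hm ?_
  rw [← Measure.measure_univ_eq_zero]
  have : (univ : Set X) = ⋃ n : ℕ, Metric.ball x (2 ^ n * r) := by
    refine (eq_univ_of_forall fun y => mem_iUnion.2 ?_).symm
    obtain ⟨n, hn⟩ := pow_unbounded_of_one_lt (dist y x / r) one_lt_two
    exact ⟨n, (div_lt_iff₀ hr).1 hn⟩
  rw [this, measure_iUnion_null_iff]
  intro n
  have := hC n x r hr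
  rw [h0, mul_zero] at this
  exact le_zero_iff.1 this

/-- If a closed ball were not totally bounded, it would contain an infinite `ε`-separated sequence.
The disjoint balls of radius `ε / 2` around it have measure bounded below by doubling, yet lie in
one ball of finite measure. -/
theorem IsDoubling.properSpace [OpensMeasurableSpace X] [CompleteSpace X]
    [IsLocallyFiniteMeasure m] (h : IsDoubling m) (hm : m ≠ 0) : ProperSpace X := by
  refine ⟨fun x R => TotallyBounded.isCompact_of_isClosed ?_ Metric.isClosed_closedBall⟩
  obtain ⟨C, hC⟩ := h.exists_measure_ball_two_pow_le
  refine Metric.totallyBounded_iff.2 fun ε hε => ?_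
  by_contra! hcov
  have : Std.Symm fun y z : X => ε ≤ dist y z := ⟨fun a b hab => by rwa [dist_comm]⟩
  obtain ⟨y, hyR, hy⟩ := exists_seq_of_forall_finset_exists' (fun y => y ∈ Metric.closedBall x R)
    (fun y z => ε ≤ dist y z) (fun s _ => by
      obtain ⟨z, hz, hzs⟩ := not_subset.1 (hcov s s.finite_toSet)
      refine ⟨z, hz, fun y hy => ?_⟩
      by_contra! hlt
      exact hzs (mem_iUnion₂.2 ⟨y, hy, by rwa [Metric.mem_ball, dist_comm]⟩))
  have hε2 : 0 < ε / 2 := half_pos hε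
  -- With this `n`, the ball of radius `2 ^ n * (ε / 2)` around each `y k` contains the unit ball
  -- around `x`.
  obtain ⟨n, hn⟩ := pow_unbounded_of_one_lt ((R + 1) / (ε / 2)) one_lt_two
  have hlow (k : ℕ) : m (Metric.ball x 1) / C ^ n ≤ m (Metric.ball (y k) (ε / 2)) := by
    refine ENNReal.div_le_of_le_mul' (le_trans (measure_mono ?_) (hC n (y k) _ hε2))
    refine Metric.ball_subset_ball' ?_
    have h1 := (div_lt_iff₀ hε2).1 hn
    have h2 : dist x (y k) ≤ R := by rw [dist_comm]; exact hyR k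
    linarith
  have hdisj : Pairwise (Function.onFun Disjoint fun k => Metric.ball (y k) (ε / 2)) :=
    fun i j hij => Metric.ball_disjoint_ball (by rw [add_halves]; exact hy hij)
  have hsub : (⋃ k, Metric.ball (y k) (ε / 2)) ⊆ Metric.ball x (R + ε) :=
    iUnion_subset fun k => Metric.ball_subset_ball' (by
      have := Metric.mem_closedBall.1 (hyR k)
      linarith)
  have hle := (measure_mono hsub).trans_lt (h.measure_ball_lt_top x (R + ε))
  rw [measure_iUnion hdisj fun k => Metric.isOpen_ball.measurableSet] at hle
  refine hle.ne (top_le_iff.1 ?_)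
  rw [← ENNReal.tsum_const_eq_top_of_ne_zero (α := ℕ) (c := m (Metric.ball x 1) / C ^ n)
    (ENNReal.div_pos (h.measure_ball_pos hm x one_pos).ne' (ENNReal.pow_ne_top
      ENNReal.coe_ne_top)).ne']
  exact ENNReal.tsum_le_tsum hlow

end Doubling

/-! ### Positive functionals on test functions -/

section Riesz

variable {X : Type*} [MetricSpace X] {Ω : Set X}

theorem IsTest.mono {f : X → ℝ} {V : Set X} (hf : IsTest V f) (hV : V ⊆ Ω) : IsTest Ω f :=
  ⟨hf.1, hf.2.1, hf.2.2.trans hV⟩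

theorem exists_isCutoff_eq_one [ProperSpace X] {K V : Set X} (hK : IsCompact K) (hV : IsOpen V)
    (hKV : K ⊆ V) : ∃ f : X → ℝ, IsCutoff V f ∧ ∀ x ∈ K, f x = 1 := by
  obtain ⟨δ, hδ, hδV⟩ := hK.exists_cthickening_subset_open hV hKV
  have hsub : tsupport (fun x => (thickenedIndicator hδ K x : ℝ)) ⊆ Metric.cthickening δ K := by
    refine closure_minimal (fun x hx => ?_) Metric.isClosed_cthickening
    by_contra hx'
    refine hx ?_
    exact NNReal.coe_eq_zero.2 (thickenedIndicator_zero hδ K fun h =>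
      hx' (Metric.thickening_subset_cthickening δ K h))
  refine ⟨fun x => thickenedIndicator hδ K x, ⟨⟨⟨_, lipschitzWith_thickenedIndicator hδ K⟩,
    hK.cthickening.of_isClosed_subset (isClosed_tsupport _) hsub, hsub.trans hδV⟩, fun x =>
    ⟨NNReal.coe_nonneg _, ?_⟩⟩, fun x hx => ?_⟩
  · exact_mod_cast thickenedIndicator_le_one hδ K x
  · exact NNReal.coe_eq_one.2 (thickenedIndicator_one hδ K hx)

theorem IsTest.hasCompactSupport_restrict {f : X → ℝ} (hf : IsTest Ω f) :
    HasCompactSupport fun x : Ω => f x := by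
  refine HasCompactSupport.intro (K := Subtype.val ⁻¹' tsupport f) ?_ fun x hx =>
    image_eq_zero_of_notMem_tsupport hx
  exact IsEmbedding.subtypeVal.isCompact_preimage_iff
    (by rw [Subtype.range_coe]; exact hf.2.2) |>.2 hf.2.1

open CompactlySupported

/-- The restriction of test functions to `Ω`. -/
def restrictTest (Ω : Set X) : testSubmodule Ω →ₗ[ℝ] C_c(Ω, ℝ) where
  toFun f := ⟨⟨fun x => (f : X → ℝ) x, f.2.continuous.comp continuous_subtype_val⟩,
    f.2.hasCompactSupport_restrict⟩
  map_add' _ _ := rfl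
  map_smul' _ _ := rfl

theorem restrictTest_apply (f : testSubmodule Ω) (x : Ω) : restrictTest Ω f x = (f : X → ℝ) x :=
  rfl

theorem restrictTest_injective (Ω : Set X) : Function.Injective (restrictTest Ω) := by
  intro f g hfg
  ext x
  by_cases hx : x ∈ Ω
  · exact DFunLike.congr_fun hfg (⟨x, hx⟩ : Ω)
  · rw [image_eq_zero_of_notMem_tsupport fun h => hx (f.2.2.2 h),
      image_eq_zero_of_notMem_tsupport fun h => hx (g.2.2.2 h)]

variable [MeasurableSpace X] [BorelSpace X]

theorem IsTest.integrable {f : X → ℝ} (hf : IsTest Ω f) (ν : Measure Ω)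
    [IsFiniteMeasureOnCompacts ν] : Integrable (fun x : Ω => f x) ν :=
  (hf.continuous.comp continuous_subtype_val).integrable_of_hasCompactSupport
    hf.hasCompactSupport_restrict

variable [ProperSpace X]

/-- A positive linear functional on the test functions is the integral for a Radon measure. -/
theorem exists_regular_integral_eq (hΩ : IsOpen Ω) (Λ : testSubmodule Ω →ₗ[ℝ] ℝ)
    (hΛ : ∀ f : testSubmodule Ω, (∀ x, 0 ≤ (f : X → ℝ) x) → 0 ≤ Λ f) :
    ∃ ν : Measure Ω, ν.Regular ∧ ∀ f : testSubmodule Ω, ∫ x : Ω, (f : X → ℝ) x ∂ν = Λ f := by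
  have : LocallyCompactSpace Ω := hΩ.locallyCompactSpace
  let e := LinearEquiv.ofInjective (restrictTest Ω) (restrictTest_injective Ω)
  let F : C_c(Ω, ℝ) →ₗ.[ℝ] ℝ := ⟨(restrictTest Ω).range, Λ ∘ₗ e.symm.toLinearMap⟩
  have hF (f : testSubmodule Ω) : F (e f) = Λ f := by
    change Λ (e.symm (e f)) = Λ f
    rw [e.symm_apply_apply]
  let s : PointedCone ℝ C_c(Ω, ℝ) :=
    { carrier := {u | ∀ x, 0 ≤ u x}
      zero_mem' := fun _ => le_rfl
      add_mem' := fun hu hv x => add_nonneg (hu x) (hv x)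
      smul_mem' := fun c _ hu x => mul_nonneg c.2 (hu x) }
  -- The M. Riesz extension theorem carries `Λ` positively from test functions to all of `C_c(Ω)`.
  -- Its second condition asks for a test function whose sum with `u` is nonnegative; a multiple of
  -- a Lipschitz cutoff equal to `1` on the support of `u` serves.
  obtain ⟨G, hG, hG0⟩ := riesz_extension s F (fun u hu => by
    obtain ⟨f, rfl⟩ := e.surjective u
    rw [hF]
    refine hΛ f fun x => ?_
    by_cases hx : x ∈ Ω
    · exact hu ⟨x, hx⟩
    · rw [image_eq_zero_of_notMem_tsupport fun h => hx (f.2.2.2 h)]) fun u => by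
    have hK : IsCompact (Subtype.val '' tsupport u) :=
      u.hasCompactSupport.image continuous_subtype_val
    obtain ⟨χ, hχ, hχ1⟩ := exists_isCutoff_eq_one hK hΩ (by rintro _ ⟨x, -, rfl⟩; exact x.2)
    obtain ⟨M, hM⟩ := u.hasCompactSupport.exists_bound_of_continuous u.continuous
    refine ⟨e ⟨fun x => |M| * χ x, hχ.1.const_mul _⟩, fun x => ?_⟩
    change 0 ≤ |M| * χ x + u x
    by_cases hx : x ∈ tsupport u
    · rw [hχ1 x ⟨x, hx, rfl⟩, mul_one]
      have := (abs_le.1 (hM x)).1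
      linarith [le_abs_self M]
    · rw [image_eq_zero_of_notMem_tsupport hx, add_zero]
      exact mul_nonneg (abs_nonneg _) (hχ.2 x).1
  let P : C_c(Ω, ℝ) →ₚ[ℝ] ℝ := PositiveLinearMap.mk₀ G fun u hu => hG0 u hu
  refine ⟨RealRMK.rieszMeasure P, inferInstance, fun f => ?_⟩
  have h1 := RealRMK.integral_rieszMeasure P (restrictTest Ω f)
  simp only [restrictTest_apply] at h1
  rw [h1, ← hF f]
  exact hG (e f)

/-! ### Comparison of Radon measures by test functions -/

theorem regular_add (hΩ : IsOpen Ω) {a b : Measure Ω} (ha : a.Regular) (hb : b.Regular) :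
    (a + b).Regular := by
  have : LocallyCompactSpace Ω := hΩ.locallyCompactSpace
  have : IsFiniteMeasureOnCompacts (a + b) := ⟨fun K hK => by
    rw [Measure.add_apply]
    exact ENNReal.add_lt_top.2 ⟨hK.measure_lt_top, hK.measure_lt_top⟩⟩
  infer_instance

/-- For compact `K ⊆ B` and open `U ⊇ K`, a Lipschitz cutoff between the indicators of `K` and `U`
gives `a K ≤ b U`. Outer regularity of `b` on `K` and inner regularity of `a` on `B` conclude. -/
theorem measure_le_of_integral_isTest_le (hΩ : IsOpen Ω) {a b : Measure Ω} [a.Regular]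
    [b.Regular] (h : ∀ f : X → ℝ, IsTest Ω f → (∀ x, 0 ≤ f x) →
      ∫ x : Ω, f x ∂a ≤ ∫ x : Ω, f x ∂b) {B : Set Ω} (hB : MeasurableSet B) (haB : a B ≠ ∞) :
    a B ≤ b B := by
  rw [hB.measure_eq_iSup_isCompact_of_ne_top haB]
  refine iSup₂_le fun K hKB => iSup_le fun hK => le_trans ?_ (measure_mono hKB)
  rw [K.measure_eq_iInf_isOpen b]
  refine le_iInf₂ fun U hKU => le_iInf fun hU => ?_
  obtain ⟨f, hf, hf1⟩ := exists_isCutoff_eq_one (hK.image continuous_subtype_val)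
    (hΩ.isOpenMap_subtype_val U hU) (image_mono hKU)
  have hfΩ : IsTest Ω f := hf.1.mono (by rintro _ ⟨x, -, rfl⟩; exact x.2)
  have hle := ENNReal.ofReal_le_ofReal (h f hfΩ fun x => (hf.2 x).1)
  rw [ofReal_integral_eq_lintegral_ofReal (hfΩ.integrable a) (.of_forall fun x => (hf.2 x).1),
    ofReal_integral_eq_lintegral_ofReal (hfΩ.integrable b) (.of_forall fun x => (hf.2 x).1)]
    at hle
  calc a K = ∫⁻ x, K.indicator 1 x ∂a := (lintegral_indicator_one hK.measurableSet).symm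
    _ ≤ ∫⁻ x : Ω, ENNReal.ofReal (f x) ∂a := lintegral_mono fun x => by
        by_cases hx : x ∈ K
        · simp [hx, hf1 x ⟨x, hx, rfl⟩]
        · simp [hx]
    _ ≤ ∫⁻ x : Ω, ENNReal.ofReal (f x) ∂b := hle
    _ ≤ ∫⁻ x, U.indicator 1 x ∂b := lintegral_mono fun x => by
        by_cases hx : x ∈ U
        · simpa [hx] using (hf.2 x).2
        · have : f x = 0 := image_eq_zero_of_notMem_tsupport fun hmem => hx (by
            obtain ⟨y, hy, hyx⟩ := hf.1.2.2 hmem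
            rwa [← Subtype.ext hyx])
          simp [this]
    _ = b U := lintegral_indicator_one hU.measurableSet

/-- Moving the negative parts across reduces the claim to the nonnegative measures `μ.pos + ν.neg`
and `ν.pos + μ.neg`, which are finite on `B`. -/
theorem SignedRadonMeasure.le_of_integral_isTest_le (hΩ : IsOpen Ω) {μ ν : SignedRadonMeasure Ω}
    (h : ∀ f : X → ℝ, IsTest Ω f → (∀ x, 0 ≤ f x) →
      μ.integral (fun x : Ω => f x) ≤ ν.integral (fun x : Ω => f x)) : μ ≤ ν := by
  intro B hB hBc
  have := μ.pos_regular
  have := μ.neg_regular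
  have := ν.pos_regular
  have := ν.neg_regular
  have ha := regular_add hΩ μ.pos_regular ν.neg_regular
  have hb := regular_add hΩ ν.pos_regular μ.neg_regular
  have hfin (a : Measure Ω) [IsFiniteMeasureOnCompacts a] : a B ≠ ∞ :=
    ((measure_mono subset_closure).trans_lt hBc.measure_lt_top).ne
  have hle := measure_le_of_integral_isTest_le hΩ (a := μ.pos + ν.neg) (b := ν.pos + μ.neg)
    (fun f hf hf0 => by
      have h1 := h f hf hf0
      unfold SignedRadonMeasure.integral at h1
      rw [integral_add_measure (hf.integrable _) (hf.integrable _),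
        integral_add_measure (hf.integrable _) (hf.integrable _)]
      linarith) hB (hfin _)
  have h1 := ENNReal.toReal_mono (hfin _) hle
  rw [Measure.add_apply, Measure.add_apply, ENNReal.toReal_add (hfin _) (hfin _),
    ENNReal.toReal_add (hfin _) (hfin _)] at h1
  simp only [SignedRadonMeasure.value, Measure.real]
  linarith

end Riesz

/-! ### Existence of the divergence and the upper bound -/

theorem mainTheorem9 {X : Type*} [MetricSpace X] [CompleteSpace X]
    [TopologicalSpace.SeparableSpace X] [MeasurableSpace X] [BorelSpace X]
    (m : Measure X) [IsLocallyFiniteMeasure m] (hm : m ≠ 0) (hdoubling : IsDoubling m)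
    (p₀ p q : ℝ) (hp₀ : 1 ≤ p₀) (hpoincare : SupportsPoincare p₀ m)
    (hpq : p.HolderConjugate q) (hp : p₀ ≤ p)
    (Ω : Set X) (hΩ : IsOpen Ω)
    (g h : X → ℝ) (hg : MemSobolevLocOn p m Ω g) (hh : MemLpLocOn q m Ω h)
    (μt : SignedRadonMeasure Ω)
    (hμt : ∀ f : X → ℝ, IsTest Ω f → (∀ x, 0 ≤ f x) →
      -∫ x in Ω, Dsign p m Ω (-h x) f g x * h x ∂m ≤ μt.integral (fun x : Ω => f x)) :
    MemDivDomain p m Ω h g ∧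
      ∀ μ : SignedRadonMeasure Ω, IsDivergence p m Ω h g μ → μ ≤ μt := by
  have : ProperSpace X := hdoubling.properSpace hm
  have := μt.pos_regular
  have := μt.neg_regular
  refine ⟨?_, fun μ hμ => SignedRadonMeasure.le_of_integral_isTest_le hΩ fun f hf hf0 =>
    (hμ f hf).2.trans (hμt f hf hf0)⟩
  obtain ⟨L, hL⟩ := exists_linearMap_le_divUpper hpq hΩ.measurableSet hg hh
  let I : testSubmodule Ω →ₗ[ℝ] ℝ :=
    { toFun := fun f => μt.integral fun x : Ω => (f : X → ℝ) x
      map_add' := fun u v => by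
        simp only [SignedRadonMeasure.integral, Submodule.coe_add, Pi.add_apply]
        rw [integral_add (u.2.integrable _) (v.2.integrable _),
          integral_add (u.2.integrable _) (v.2.integrable _)]
        ring
      map_smul' := fun c u => by
        simp only [SignedRadonMeasure.integral, Submodule.coe_smul, Pi.smul_apply, smul_eq_mul,
          integral_const_mul, RingHom.id_apply]
        ring }
  -- On nonnegative `f`, `L f ≤ divUpper f ≤ ∫ f dμt`, so `I - L` is positive. The divergence is
  -- then `μt - ν`, whose integral on test functions is `L`.
  obtain ⟨ν, hν, hνI⟩ := exists_regular_integral_eq hΩ (I - L) fun f hf0 =>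
    sub_nonneg.2 ((hL f).trans (hμt f f.2 hf0))
  refine ⟨⟨μt.pos, μt.neg + ν, μt.pos_regular, regular_add hΩ μt.neg_regular hν⟩, fun f hf => ?_⟩
  have hint : SignedRadonMeasure.integral
      ⟨μt.pos, μt.neg + ν, μt.pos_regular, regular_add hΩ μt.neg_regular hν⟩
      (fun x : Ω => f x) = L ⟨f, hf⟩ := by
    have h1 : ∫ x : Ω, f x ∂ν = μt.integral (fun x : Ω => f x) - L ⟨f, hf⟩ := hνI ⟨f, hf⟩
    simp only [SignedRadonMeasure.integral] at h1 ⊢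
    rw [integral_add_measure (hf.integrable _) (hf.integrable _), h1]
    ring
  rw [hint]
  refine ⟨?_, hL ⟨f, hf⟩⟩
  -- The lower bound for `f` is the upper bound for `-f`.
  have h1 : L (-⟨f, hf⟩) ≤ _ := hL (-⟨f, hf⟩)
  rw [map_neg] at h1
  rw [neg_integral_Dsign_mul]
  exact neg_le.1 h1
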